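/- Consider an M/GI/1 queue under the Foreground-Background (FB) policy: jobs arrive according to a Poisson process of rate $\lambda>0$, have i.i.d. service requirements distributed as $B$ (independent of the arrivals), and at any moment the server shares its unit capacity equally over all jobs in the system that have received the least amount of service so far. Let $T_{\mathrm{FB}}$ be the sojourn time (time between arrival and completion) of a job in steady state, that is, the weak limit, as $n\to\infty$, of the sojourn time of the $n$-th job in an initially empty system. Let $x_L>0$, $\alpha>1$, and let $B$ be Pareto distributed: $\overline F(x)=\mathbb P(B>x)=(x/x_L)^{-\alpha}$ for $x\ge x_L$. Put $\rho=\lambda\,\mathbb E[B]$. For every $\rho\in(0,1)$ this limit exists and has finite mean, and as $\rho\uparrow 1$ (with $F$ fixed) $$\mathbb E[T_{\mathrm{FB}}]\sim\begin{cases}\dfrac{\alpha}{2-\alpha}\,\mathbb E[B]\,\log\dfrac1{1-\rho} & \text{if }\alpha\in(1,2),\\[2ex] \dfrac{\pi/(\alpha-1)}{2\sin(\pi/(\alpha-1))}\;\dfrac{\mathbb E[B^2]\,\alpha^{\alpha/(\alpha-1)}}{x_L\,(1-\rho)^{(\alpha-2)/(\alpha-1)}} & \text{if }\alpha\in(2,\infty),\end{cases}$$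 where $f\sim g$ means that $f/g\to1$. -/

import Mathlib

open MeasureTheory ProbabilityTheory Filter Topology Asymptotics
open scoped ENNReal NNReal

namespace FBQueue

noncomputable section

/-- Arrival time of customer `n` in an initially empty queue, when `A 0, A 1, …` are the
successive interarrival times. -/
def arrivalTime (A : ℕ → ℝ) (n : ℕ) : ℝ := ∑ k ∈ Finset.range (n + 1), A k

/-- In the next definitions, `τ i` is the arrival time and `b i` the service requirement of
job `i`, and `a i t` is the amount of service that job `i` has received by time `t`.
Job `i` is in the system at time `t` if it has arrived and is not yet completed. -/
def InSystem (τ b : ℕ → ℝ) (a : ℕ → ℝ → ℝ) (i : ℕ) (t : ℝ) : Prop :=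
  τ i ≤ t ∧ a i t < b i

/-- The jobs in the system at time `t` that have received the least amount of service so far. -/
def leastAttained (τ b : ℕ → ℝ) (a : ℕ → ℝ → ℝ) (t : ℝ) : Set ℕ :=
  {i | InSystem τ b a i t ∧ ∀ j, InSystem τ b a j t → a i t ≤ a j t}

open Classical in
/-- Foreground-Background service rates: the unit capacity of the server is shared equally over
all jobs in the system that have received the least amount of service so far. (With
probability one, finitely many jobs have arrived by any given time.) -/
def serviceRate (τ b : ℕ → ℝ) (a : ℕ → ℝ → ℝ) (i : ℕ) (t : ℝ) : ℝ :=
  if i ∈ leastAttained τ b a t then ((leastAttained τ b a t).ncard : ℝ)⁻¹ else 0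

/-- `a` is the evolution of the attained services under the Foreground-Background policy,
in a system that starts empty at time `0`. -/
structure IsFBSchedule (τ b : ℕ → ℝ) (a : ℕ → ℝ → ℝ) : Prop where
  intervalIntegrable : ∀ i t, 0 ≤ t → IntervalIntegrable (serviceRate τ b a i) volume 0 t
  attained_eq : ∀ i t, 0 ≤ t → a i t = ∫ s in (0 : ℝ)..t, serviceRate τ b a i s

/-- Sojourn time of job `n`: the time between its arrival and the first moment at which its
attained service equals its service requirement (`∞` if there is no such moment). -/
def sojournTime (τ b : ℕ → ℝ) (a : ℕ → ℝ → ℝ) (n : ℕ) : ℝ≥0∞ :=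
  ⨅ (t : ℝ≥0) (_ : b n ≤ a n (τ n + t)), (t : ℝ≥0∞)

variable {Ω : Type*} [MeasurableSpace Ω]

/-- An M/GI/1 queue under the Foreground-Background policy, initially empty, on the probability
space `(Ω, P)`: the interarrival times `A n` are exponential with rate `lam` (Poisson arrivals),
the service requirements `B n` have law `F`, all these variables are mutually independent, and
`S i t` is the service attained by job `i` at time `t`. -/
structure IsMGI1FB (P : Measure Ω) (lam : ℝ) (F : Measure ℝ)
    (A B : ℕ → Ω → ℝ) (S : ℕ → ℝ → Ω → ℝ) : Prop where
  interarrival_law : ∀ n, HasLaw (A n) (expMeasure lam) P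
  service_law : ∀ n, HasLaw (B n) F P
  indep : iIndepFun (fun k : ℕ ⊕ ℕ => Sum.elim A B k) P
  schedule : ∀ᵐ ω ∂P,
    IsFBSchedule (arrivalTime fun n => A n ω) (fun n => B n ω) (fun i t => S i t ω)

/-- Sojourn time of customer `n` as a random variable. -/
def sojourn (A B : ℕ → Ω → ℝ) (S : ℕ → ℝ → Ω → ℝ) (n : ℕ) (ω : Ω) : ℝ≥0∞ :=
  sojournTime (arrivalTime fun k => A k ω) (fun k => B k ω) (fun i t => S i t ω) n

/-- `ν` is the steady-state (invariant) law of the sojourn time: the weak limit of the law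
of the sojourn time of customer `n` as `n → ∞`. -/
def IsSteadyStateSojournLaw (P : Measure Ω) [IsProbabilityMeasure P]
    (A B : ℕ → Ω → ℝ) (S : ℕ → ℝ → Ω → ℝ) (ν : ProbabilityMeasure ℝ≥0∞) : Prop :=
  TendstoInDistribution (sojourn A B S) atTop (id : ℝ≥0∞ → ℝ≥0∞) (fun _ => P) (ν : Measure ℝ≥0∞)

end

end FBQueue

/-! Fix a job of size x. Under FB it competes only with the first x units of every job, because a
job that has attained x is not served while some job below x is unfinished. So the work left below
level x, summed over the arrived jobs, falls at unit rate until it vanishes: it is the workload of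
an ordinary single server queue with services min(B, x) (`remaining_arrival`). The tagged job is
completed exactly when this work first vanishes after its arrival, since any job lagging behind
would have been served in its place. Its sojourn time is thus the length of a busy period started by
the workload found plus x (`sojournTime_eq`).

Reversing the order of the i.i.d. pairs (service, next gap) realises all sojourn times, in law, on
one space, where they increase with the number of predecessors. The almost sure limit yields the
weak limit (`isSteadyState`).

Let m(x) and s(x) be the first two moments of min(B, x). First-step analysis over an exponential gap
gives w / (1 - λ m) for the mean busy period started by w (`iSup_meanStep`) and λ s / (2 (1 - λ m))
for the mean workload (`iSup_meanWorkload`). Conditioning on the size b of the tagged job, E[T] is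
the F-integral of (b + λ s(b) / (2 (1 - λ m(b)))) / (1 - λ m(b)) (`lintegral_limitLaw`).

For the Pareto law put p = 1/(α - 1) and B = xL V^(-p), where V has density (1 + p) v^p on (0, 1).
Then 1 - λ m becomes D = (1 - ρ) + ρ p/(1 + p) v, linear in v, and E[T] is a combination of the
integrals over (0, 1) of 1/D, v/D² and v^p/D² (`integral_fbMean_pareto`). The first two grow like
log(1/(1 - ρ)). If α < 2, then p > 1 and the third stays bounded, so the logarithms decide. If α >
2, then p < 1 and the third is of order (1 - ρ)^(p - 1), with a constant given by the Beta integral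
of s^p/(1 + s)², and it dominates. -/

namespace FBQueue

/-! ### Recursions for the workload and the busy period -/

/-- The workload found by customer `k` in the single server queue in which every service
requirement is truncated at `x`; `y k` consists of the service requirement of customer `k` and the
time between the arrivals of customers `k` and `k + 1`. -/
noncomputable def workload (x : ℝ) (y : ℕ → ℝ × ℝ) : ℕ → ℝ
  | 0 => 0
  | k + 1 => max (workload x y k + min (y k).1 x - (y k).2) 0

/-- The shifted sequence. -/
def tail (z : ℕ → ℝ × ℝ) : ℕ → ℝ × ℝ := fun k => z (k + 1)

/-- The time needed to clear the workload `v`, the requirement of customer `0`, and the requirements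
of the next customers (at most `m - 1`) arriving in the meantime, all truncated at `x`. -/
noncomputable def busy (x : ℝ) : ℕ → ℝ → (ℕ → ℝ × ℝ) → ℝ
  | 0, v, _ => v
  | m + 1, v, z =>
    if (z 0).2 < v + min (z 0).1 x then
      (z 0).2 + busy x m (v + min (z 0).1 x - (z 0).2) (tail z)
    else v + min (z 0).1 x

lemma busy_one (x v : ℝ) (z : ℕ → ℝ × ℝ) : busy x 1 v z = v + min (z 0).1 x := by
  simp only [busy]; split_ifs <;> ring

/-! ### Pathwise analysis of a Foreground-Background schedule -/

section Schedule

variable {τ b : ℕ → ℝ} {a : ℕ → ℝ → ℝ}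

lemma serviceRate_nonneg (i : ℕ) (t : ℝ) : 0 ≤ serviceRate τ b a i t := by
  unfold serviceRate; split_ifs <;> positivity

lemma serviceRate_eq_zero_of_not_inSystem {i : ℕ} {t : ℝ} (h : ¬ InSystem τ b a i t) :
    serviceRate τ b a i t = 0 := by
  unfold serviceRate
  rw [if_neg]
  exact fun hi => h hi.1

lemma serviceRate_eq_zero_of_lt {i j : ℕ} {t : ℝ} (hj : InSystem τ b a j t)
    (h : a j t < a i t) : serviceRate τ b a i t = 0 := by
  unfold serviceRate
  rw [if_neg]
  exact fun hi => absurd (hi.2 j hj) (not_le.2 h)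

lemma sum_serviceRate_le_one (s : Finset ℕ) (t : ℝ) :
    ∑ i ∈ s, serviceRate τ b a i t ≤ 1 := by
  classical
  unfold serviceRate
  rw [← Finset.sum_filter, Finset.sum_const, nsmul_eq_mul]
  by_cases hfin : (leastAttained τ b a t).Finite
  · have : (s.filter (fun i => i ∈ leastAttained τ b a t)).card
        ≤ (leastAttained τ b a t).ncard := by
      rw [← Set.ncard_coe_finset]
      exact Set.ncard_le_ncard (fun i hi => by simpa using (Finset.mem_filter.1 hi).2) hfin
    rw [← div_eq_mul_inv]
    exact div_le_one_of_le₀ (by exact_mod_cast this) (by positivity)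
  -- If infinitely many jobs tie, `ncard` takes its default value 0 and every rate vanishes.
  · simp [Set.Infinite.ncard hfin]

/-- Work conservation: among finitely many jobs present, the least attained service is achieved by
someone, so the equal shares add up to one. -/
lemma sum_serviceRate_eq_one {k : ℕ} {t : ℝ} (hk : ∀ i, InSystem τ b a i t → i ≤ k)
    {j : ℕ} (hj : InSystem τ b a j t) :
    ∑ i ∈ Finset.range (k + 1), serviceRate τ b a i t = 1 := by
  classical
  have hsub : leastAttained τ b a t ⊆ Finset.range (k + 1) := fun i hi => by
    simpa [Nat.lt_succ_iff] using hk i hi.1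
  have hfin : (leastAttained τ b a t).Finite := (Finset.finite_toSet _).subset hsub
  have hne : (leastAttained τ b a t).Nonempty := by
    obtain ⟨i, hi, hmin⟩ := Set.exists_min_image {i | InSystem τ b a i t} (fun i => a i t)
      ((Set.finite_Iic k).subset fun i hi => hk i hi) ⟨j, hj⟩
    exact ⟨i, hi, hmin⟩
  unfold serviceRate
  rw [← Finset.sum_filter, Finset.sum_const, nsmul_eq_mul]
  have : (((Finset.range (k + 1)).filter (fun i => i ∈ leastAttained τ b a t) : Finset ℕ) : Set ℕ)
      = leastAttained τ b a t := by
    ext i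
    simp only [Finset.coe_filter, Set.mem_ofPred_eq, and_iff_right_iff_imp]
    exact fun hi => by simpa using hsub hi
  rw [← Set.ncard_coe_finset, this]
  exact mul_inv_cancel₀ (by simpa [Set.ncard_eq_zero hfin] using hne.ne_empty)

namespace IsFBSchedule

variable (h : IsFBSchedule τ b a)
include h

lemma intervalIntegrable' (i : ℕ) {s t : ℝ} (hs : 0 ≤ s) (ht : 0 ≤ t) :
    IntervalIntegrable (serviceRate τ b a i) volume s t :=
  (h.intervalIntegrable i s hs).symm.trans (h.intervalIntegrable i t ht)

lemma attained_sub (i : ℕ) {s t : ℝ} (hs : 0 ≤ s) (ht : 0 ≤ t) :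
    a i t - a i s = ∫ u in s..t, serviceRate τ b a i u := by
  rw [h.attained_eq i t ht, h.attained_eq i s hs,
    intervalIntegral.integral_interval_sub_left (h.intervalIntegrable i t ht)
      (h.intervalIntegrable i s hs)]

lemma attained_mono (i : ℕ) {s t : ℝ} (hs : 0 ≤ s) (hst : s ≤ t) : a i s ≤ a i t := by
  have := h.attained_sub i hs (hs.trans hst)
  have h2 := intervalIntegral.integral_nonneg (μ := volume) hst
    (fun u _ => serviceRate_nonneg (τ := τ) (b := b) (a := a) i u)
  linarith

lemma sum_attained_sub_le (I : Finset ℕ) {s t : ℝ} (hs : 0 ≤ s) (hst : s ≤ t) :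
    ∑ i ∈ I, (a i t - a i s) ≤ t - s := by
  have ht := hs.trans hst
  simp_rw [fun i => h.attained_sub i hs ht]
  rw [← intervalIntegral.integral_finsetSum fun i _ => h.intervalIntegrable' i hs ht]
  calc _ ≤ ∫ _ in s..t, (1 : ℝ) := by
        refine intervalIntegral.integral_mono_on hst ?_ (by simp)
          fun u _ => sum_serviceRate_le_one I u
        simpa only [← Finset.sum_apply] using
          IntervalIntegrable.sum _ fun i _ => h.intervalIntegrable' i hs ht
    _ = t - s := by simp

lemma attained_sub_le (i : ℕ) {s t : ℝ} (hs : 0 ≤ s) (hst : s ≤ t) : a i t - a i s ≤ t - s := by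
  simpa using h.sum_attained_sub_le {i} hs hst

lemma continuousOn_attained (i : ℕ) : ContinuousOn (a i) (Set.Ici 0) := by
  have : LipschitzOnWith 1 (a i) (Set.Ici 0) := by
    refine LipschitzOnWith.of_le_add_mul 1 fun s hs t ht => ?_
    simp only [NNReal.coe_one, one_mul, Real.dist_eq]
    rcases le_total s t with hst | hst
    · linarith [h.attained_mono i hs hst, abs_nonneg (s - t)]
    · linarith [h.attained_sub_le i ht hst, le_abs_self (s - t)]
  exact this.continuousOn

lemma attained_eq_of_rate_eq_zero (i : ℕ) {s t : ℝ} (hs : 0 ≤ s) (hst : s ≤ t)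
    (h0 : ∀ u ∈ Set.Ioo s t, serviceRate τ b a i u = 0) : a i t = a i s := by
  have := h.attained_sub i hs (hs.trans hst)
  rw [intervalIntegral.integral_of_le hst, integral_Ioc_eq_integral_Ioo,
    setIntegral_congr_fun measurableSet_Ioo h0] at this
  simp at this
  linarith

/-- A job that is never served above level `L` does not get above that level. -/
lemma attained_le_max (i : ℕ) {L s t : ℝ} (hs : 0 ≤ s) (hst : s ≤ t)
    (h0 : ∀ u ∈ Set.Ico s t, L < a i u → serviceRate τ b a i u = 0) :
    a i t ≤ max (a i s) L := by
  -- The last time of `C` is the last moment at which the bound holds. After it the job is above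
  -- `L`, hence unserved, so its attained service stays constant up to `t`.
  set C := Set.Icc s t ∩ a i ⁻¹' Set.Iic (max (a i s) L) with hC
  have hcl : IsClosed C :=
    ((h.continuousOn_attained i).mono fun u hu => hs.trans hu.1).preimage_isClosed_of_isClosed
      isClosed_Icc isClosed_Iic
  have hne : C.Nonempty := ⟨s, ⟨le_rfl, hst⟩, le_max_left (a i s) L⟩
  have hbd : BddAbove C := ⟨t, fun u hu => hu.1.2⟩
  obtain ⟨hmem, hle⟩ := hcl.csSup_mem hne hbd
  have hconst := h.attained_eq_of_rate_eq_zero i (hs.trans hmem.1) hmem.2 fun u hu => by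
    refine h0 u ⟨hmem.1.trans hu.1.le, hu.2⟩ ?_
    by_contra hcon
    have : u ∈ C := ⟨⟨hmem.1.trans hu.1.le, hu.2.le⟩, (not_lt.1 hcon).trans (le_max_right _ _)⟩
    exact absurd (le_csSup hbd this) (not_le.2 hu.1)
  rw [hconst]
  exact hle

lemma attained_eq_zero (i : ℕ) {t : ℝ} (ht : 0 ≤ t) (hti : t ≤ τ i) : a i t = 0 := by
  rw [h.attained_eq_of_rate_eq_zero i le_rfl ht fun u hu =>
    serviceRate_eq_zero_of_not_inSystem fun hin => absurd hin.1 (not_le.2 (hu.2.trans_le hti)),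
    h.attained_eq i 0 le_rfl]
  simp

lemma attained_le_requirement (hb : ∀ i, 0 < b i) (i : ℕ) {t : ℝ} (ht : 0 ≤ t) : a i t ≤ b i := by
  have h0 : a i 0 = 0 := by rw [h.attained_eq i 0 le_rfl]; simp
  have := h.attained_le_max i (L := b i) le_rfl ht fun u _ hu =>
    serviceRate_eq_zero_of_not_inSystem fun hin => absurd hin.2 (not_lt.2 hu.le)
  rwa [h0, max_eq_right (hb i).le] at this

end IsFBSchedule

/-- The total amount of service still to be given at time `t` to the jobs `0, …, k` before each of
them is completed or has attained the level `x`. -/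
noncomputable def remaining (b : ℕ → ℝ) (a : ℕ → ℝ → ℝ) (x : ℝ) (k : ℕ) (t : ℝ) : ℝ :=
  ∑ i ∈ Finset.range (k + 1), (min (b i) x - min (a i t) x)

namespace IsFBSchedule

variable (h : IsFBSchedule τ b a) (hb : ∀ i, 0 < b i)
include h hb

lemma remaining_term_nonneg (x : ℝ) (i : ℕ) {t : ℝ} (ht : 0 ≤ t) :
    0 ≤ min (b i) x - min (a i t) x :=
  sub_nonneg.2 (min_le_min_right _ (h.attained_le_requirement hb i ht))

lemma remaining_nonneg (x : ℝ) (k : ℕ) {t : ℝ} (ht : 0 ≤ t) : 0 ≤ remaining b a x k t :=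
  Finset.sum_nonneg fun i _ => h.remaining_term_nonneg hb x i ht

omit hb in
lemma remaining_sub_le (x : ℝ) (k : ℕ) {s t : ℝ} (hs : 0 ≤ s) (hst : s ≤ t) :
    remaining b a x k s - remaining b a x k t ≤ t - s := by
  refine le_trans ?_ (h.sum_attained_sub_le (Finset.range (k + 1)) hs hst)
  rw [remaining, remaining, ← Finset.sum_sub_distrib]
  refine Finset.sum_le_sum fun i _ => ?_
  have := h.attained_mono i hs hst
  grind

lemma exists_lt_of_remaining_ne_zero {x : ℝ} {k : ℕ} {t : ℝ} (ht : 0 ≤ t)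
    (hne : remaining b a x k t ≠ 0) : ∃ j ≤ k, a j t < min (b j) x := by
  obtain ⟨j, hj, hjne⟩ := Finset.exists_ne_zero_of_sum_ne_zero hne
  refine ⟨j, by simpa [Nat.lt_succ_iff] using hj, ?_⟩
  have := h.attained_le_requirement hb j ht
  grind

/-- A job still short of its truncated requirement at `t` was present and below level `x` ever since
`τ k`. So the server never idled, and no job above `x` was served: all capacity went into truncated
work. -/
lemma remaining_eq_sub {x : ℝ} {k : ℕ} {t : ℝ} (hτ : StrictMono τ) (hτ0 : 0 < τ 0)
    (hkt : τ k ≤ t) (htk : t ≤ τ (k + 1)) (hne : remaining b a x k t ≠ 0) :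
    remaining b a x k t = remaining b a x k (τ k) - (t - τ k) := by
  have hk0 : 0 ≤ τ k := hτ0.le.trans (hτ.monotone (Nat.zero_le k))
  have ht0 := hk0.trans hkt
  obtain ⟨j, hjk, hj⟩ := h.exists_lt_of_remaining_ne_zero hb ht0 hne
  have hjin : ∀ u ∈ Set.Ico (τ k) t, InSystem τ b a j u ∧ a j u < x := fun u hu => by
    have h1 := h.attained_mono j (hk0.trans hu.1) hu.2.le
    exact ⟨⟨(hτ.monotone hjk).trans hu.1, h1.trans_lt (hj.trans_le (min_le_left _ _))⟩,
      h1.trans_lt (hj.trans_le (min_le_right _ _))⟩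
  have hsum : ∑ i ∈ Finset.range (k + 1), (a i t - a i (τ k)) = t - τ k := by
    simp_rw [fun i => h.attained_sub i hk0 ht0]
    rw [← intervalIntegral.integral_finsetSum fun i _ => h.intervalIntegrable' i hk0 ht0,
      intervalIntegral.integral_of_le hkt, integral_Ioc_eq_integral_Ioo,
      setIntegral_congr_fun (g := fun _ => (1 : ℝ)) measurableSet_Ioo]
    · simp [hkt]
    · intro u hu
      refine sum_serviceRate_eq_one (fun i hi => ?_) (hjin u ⟨hu.1.le, hu.2⟩).1
      have := hi.1.trans_lt (hu.2.trans_le htk)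
      exact Nat.lt_succ_iff.1 (hτ.lt_iff_lt.1 this)
  rw [← hsum, eq_sub_iff_add_eq, remaining, remaining, ← Finset.sum_add_distrib]
  refine Finset.sum_congr rfl fun i _ => ?_
  have h1 := h.attained_le_max i (L := x) hk0 hkt fun u hu hxu =>
    serviceRate_eq_zero_of_lt (hjin u hu).1 ((hjin u hu).2.trans hxu)
  have h2 := h.attained_mono i hk0 hkt
  grind

lemma remaining_eq_max {x : ℝ} {k : ℕ} {t : ℝ} (hτ : StrictMono τ) (hτ0 : 0 < τ 0)
    (hkt : τ k ≤ t) (htk : t ≤ τ (k + 1)) :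
    remaining b a x k t = max (remaining b a x k (τ k) - (t - τ k)) 0 := by
  have hk0 : 0 ≤ τ k := hτ0.le.trans (hτ.monotone (Nat.zero_le k))
  by_cases hne : remaining b a x k t = 0
  · have := h.remaining_sub_le x k hk0 hkt
    rw [max_eq_right (by linarith), hne]
  · rw [← h.remaining_eq_sub hb hτ hτ0 hkt htk hne,
      max_eq_left (h.remaining_nonneg hb x k (hk0.trans hkt))]

/-- Lindley's recursion: between arrivals the truncated work falls at unit rate until it hits zero,
and a newcomer adds its own truncated requirement. Thus FB behaves below level `x` like any
work-conserving discipline. -/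
lemma remaining_arrival {x : ℝ} (hx : 0 ≤ x) (hτ : StrictMono τ) (hτ0 : 0 < τ 0) (k : ℕ) :
    remaining b a x k (τ k) =
      workload x (fun k => (b k, τ (k + 1) - τ k)) k + min (b k) x := by
  induction k with
  | zero =>
    simp [remaining, workload, h.attained_eq_zero 0 hτ0.le le_rfl, hx]
  | succ k ih =>
    have hk : τ k ≤ τ (k + 1) := hτ.monotone (Nat.le_succ k)
    have hk0 : 0 ≤ τ (k + 1) := hτ0.le.trans (hτ.monotone (Nat.zero_le _))
    have := h.remaining_eq_max hb (x := x) hτ hτ0 hk le_rfl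
    rw [remaining, Finset.sum_range_succ, ← remaining, this, ih,
      h.attained_eq_zero (k + 1) hk0 le_rfl, min_eq_left hx, workload, sub_zero]

/-- When job `n` is completed, no job that arrived before has work left below level `b n`. -/
lemma remaining_eq_zero_of_completed {n k : ℕ} {t : ℝ} (hτ : StrictMono τ) (hτ0 : 0 < τ 0)
    (hkt : τ k ≤ t) (hlt : a n (τ k) < b n) (hle : b n ≤ a n t) :
    remaining b a (b n) k t = 0 := by
  have hk0 : 0 ≤ τ k := hτ0.le.trans (hτ.monotone (Nat.zero_le k))
  by_contra hne
  obtain ⟨j, hjk, hj⟩ := h.exists_lt_of_remaining_ne_zero hb (hk0.trans hkt) hne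
  -- A job `j` still lagging at time `t` keeps job `n` from being served above level `a j t`, which
  -- is below `b n`.
  have := h.attained_le_max n (L := a j t) hk0 hkt fun u hu hju => by
    have h1 := h.attained_mono j (hk0.trans hu.1) hu.2.le
    exact serviceRate_eq_zero_of_lt ⟨(hτ.monotone hjk).trans hu.1,
      h1.trans_lt (hj.trans_le (min_le_left _ _))⟩ (h1.trans_lt hju)
  exact absurd (hle.trans this) (not_le.2 (max_lt hlt (hj.trans_le (min_le_right _ _))))

lemma completed_of_remaining_eq_zero {n k : ℕ} {t : ℝ} (hnk : n ≤ k) (ht : 0 ≤ t)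
    (h0 : remaining b a (b n) k t = 0) : b n ≤ a n t := by
  have := (Finset.sum_eq_zero_iff_of_nonneg
    fun i _ => h.remaining_term_nonneg hb (b n) i ht).1 h0 n (by simp; omega)
  simp only [min_self] at this
  grind

/-- Completion requires clearing the whole truncated work at unit speed. If the next arrival comes
earlier, job `n` is still incomplete then, and the argument restarts from `k + 1`. -/
lemma le_of_completed {n k m : ℕ} {t : ℝ} (hτ : StrictMono τ) (hτ0 : 0 < τ 0)
    (hlt : a n (τ k) < b n) (hkt : τ k ≤ t) (hle : b n ≤ a n t) :
    τ k + busy (b n) (m + 1) (workload (b n) (fun k => (b k, τ (k + 1) - τ k)) k)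
      (fun i => (b (k + i), τ (k + i + 1) - τ (k + i))) ≤ t := by
  have hk0 : ∀ k, 0 ≤ τ k := fun k => hτ0.le.trans (hτ.monotone (Nat.zero_le k))
  have key : ∀ k s, τ k ≤ s → a n (τ k) < b n → b n ≤ a n s →
      workload (b n) (fun k => (b k, τ (k + 1) - τ k)) k + min (b k) (b n) ≤ s - τ k := by
    intro k s hks hlt hs
    have h1 := h.remaining_sub_le (b n) k (hk0 k) hks
    rw [h.remaining_eq_zero_of_completed hb hτ hτ0 hks hlt hs,
      h.remaining_arrival hb (hb n).le hτ hτ0] at h1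
    linarith
  induction m generalizing k with
  | zero =>
    rw [busy_one]
    have := key k t hkt hlt hle
    simp only [add_zero]
    linarith
  | succ m ih =>
    rw [busy]
    simp only [add_zero]
    split_ifs with hif
    · have hlt' : a n (τ (k + 1)) < b n := by
        by_contra hcon
        have := key k (τ (k + 1)) (hτ.monotone (Nat.le_succ k)) hlt (not_lt.1 hcon)
        linarith
      have hkt' : τ (k + 1) ≤ t := by
        by_contra hcon
        exact absurd (hle.trans (h.attained_mono n ((hk0 k).trans hkt) (not_le.1 hcon).le))
          (not_le.2 hlt')
      have := ih hlt' hkt'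
      rw [workload, max_eq_left (by simp only; linarith)] at this
      have e : tail (fun i => (b (k + i), τ (k + i + 1) - τ (k + i)))
          = fun i => (b (k + 1 + i), τ (k + 1 + i + 1) - τ (k + 1 + i)) := by
        funext i
        simp only [tail, show k + (i + 1) = k + 1 + i by omega]
      rw [e]
      linarith
    · have := key k t hkt hlt hle
      linarith

/-- Converse bound. The second alternative covers a busy period that outlasts the `m + 1` customers
taken into account: its truncated length then reaches past the next arrival. -/
lemma exists_completed_or_le {n k m : ℕ} (hτ : StrictMono τ) (hτ0 : 0 < τ 0) (hnk : n ≤ k)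
    (hlt : a n (τ k) < b n) :
    (∃ t, τ n ≤ t ∧ b n ≤ a n t ∧
      t ≤ τ k + busy (b n) (m + 1) (workload (b n) (fun k => (b k, τ (k + 1) - τ k)) k)
        (fun i => (b (k + i), τ (k + i + 1) - τ (k + i)))) ∨
    τ (k + m + 1) ≤ τ k +
      busy (b n) (m + 1) (workload (b n) (fun k => (b k, τ (k + 1) - τ k)) k)
        (fun i => (b (k + i), τ (k + i + 1) - τ (k + i))) := by
  have hk0 : ∀ k, 0 ≤ τ k := fun k => hτ0.le.trans (hτ.monotone (Nat.zero_le k))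
  have key : ∀ k s, n ≤ k → τ k ≤ s → s ≤ τ (k + 1) →
      workload (b n) (fun k => (b k, τ (k + 1) - τ k)) k + min (b k) (b n) ≤ s - τ k →
      b n ≤ a n s := by
    intro k s hnk hks hsk hw
    refine h.completed_of_remaining_eq_zero hb hnk ((hk0 k).trans hks) ?_
    rw [h.remaining_eq_max hb hτ hτ0 hks hsk, h.remaining_arrival hb (hb n).le hτ hτ0]
    exact max_eq_right (by linarith)
  have hpos : ∀ k,
      0 ≤ workload (b n) (fun k => (b k, τ (k + 1) - τ k)) k + min (b k) (b n) := by
    intro k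
    rw [← h.remaining_arrival hb (hb n).le hτ hτ0]
    exact h.remaining_nonneg hb _ _ (hk0 k)
  induction m generalizing k with
  | zero =>
    rw [busy_one]
    simp only [add_zero]
    by_cases hif : τ (k + 1) - τ k <
      workload (b n) (fun k => (b k, τ (k + 1) - τ k)) k + min (b k) (b n)
    · right; linarith
    · left
      refine ⟨_, ?_, key k _ hnk ?_ ?_ (le_of_eq ?_), le_rfl⟩
      · linarith [hpos k, hτ.monotone hnk]
      · linarith [hpos k]
      · linarith
      · ring
  | succ m ih =>
    rw [busy]
    simp only [add_zero]
    split_ifs with hif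
    · have hk1 : τ k ≤ τ (k + 1) := hτ.monotone (Nat.le_succ k)
      have hlt' : a n (τ (k + 1)) < b n := by
        by_contra hcon
        have h0 := h.remaining_eq_zero_of_completed hb hτ hτ0 hk1 hlt (not_lt.1 hcon)
        have h1 := h.remaining_sub_le (b n) k (hk0 k) hk1
        rw [h0, h.remaining_arrival hb (hb n).le hτ hτ0] at h1
        linarith
      have := ih (hnk.trans (Nat.le_succ k)) hlt'
      rw [workload, max_eq_left (by simp only; linarith)] at this
      have e : tail (fun i => (b (k + i), τ (k + i + 1) - τ (k + i)))
          = fun i => (b (k + 1 + i), τ (k + 1 + i + 1) - τ (k + 1 + i)) := by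
        funext i
        simp only [tail, show k + (i + 1) = k + 1 + i by omega]
      rw [e]
      rcases this with ⟨t, h1, h2, h3⟩ | h1
      · left; exact ⟨t, h1, h2, by linarith⟩
      · right
        rw [show k + (m + 1) + 1 = k + 1 + m + 1 by omega]
        linarith
    · left
      refine ⟨_, ?_, key k _ hnk ?_ ?_ (le_of_eq ?_), le_rfl⟩
      · linarith [hpos k, hτ.monotone hnk]
      · linarith [hpos k]
      · linarith
      · ring

theorem sojournTime_eq (hτ : StrictMono τ) (hτ0 : 0 < τ 0) (hlim : Tendsto τ atTop atTop)
    (n : ℕ) :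
    sojournTime τ b a n = ⨆ m : ℕ, ENNReal.ofReal
      (busy (b n) (m + 1) (workload (b n) (fun k => (b k, τ (k + 1) - τ k)) n)
        (fun i => (b (n + i), τ (n + i + 1) - τ (n + i)))) := by
  have hn0 : 0 ≤ τ n := hτ0.le.trans (hτ.monotone (Nat.zero_le n))
  have hlt : a n (τ n) < b n := by rw [h.attained_eq_zero n hn0 le_rfl]; exact hb n
  apply le_antisymm
  · by_cases hex : ∃ m : ℕ, ∃ t, τ n ≤ t ∧ b n ≤ a n t ∧
      t ≤ τ n + busy (b n) (m + 1) (workload (b n) (fun k => (b k, τ (k + 1) - τ k)) n)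
        (fun i => (b (n + i), τ (n + i + 1) - τ (n + i)))
    · obtain ⟨m, t, h1, h2, h3⟩ := hex
      refine le_trans ?_ (le_iSup _ m)
      refine iInf₂_le_of_le (Real.toNNReal (t - τ n)) ?_ ?_
      · rw [Real.coe_toNNReal _ (by linarith)]
        simpa using h2
      · exact ENNReal.ofReal_le_ofReal (by linarith)
    -- If no stage clears the work, the truncated busy periods outlast every later arrival, so their
    -- supremum is infinite because `τ` tends to infinity.
    · refine le_top.trans (le_of_tendsto' (x := atTop)
        (f := fun m : ℕ => ENNReal.ofReal (τ (n + m + 1) - τ n)) ?_ fun m => ?_)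
      · refine ENNReal.tendsto_ofReal_atTop.comp (tendsto_atTop_add_const_right _ _ ?_)
        exact hlim.comp (tendsto_atTop_mono (fun m => by simp only [id]; omega) tendsto_id)
      · refine le_iSup_of_le m (ENNReal.ofReal_le_ofReal ?_)
        have := (h.exists_completed_or_le hb hτ hτ0 le_rfl hlt).resolve_left
          (fun hc => hex ⟨m, hc⟩)
        linarith
  · refine le_iInf₂ fun t ht => iSup_le fun m => ?_
    refine ENNReal.ofReal_le_of_le_toReal ?_
    have := h.le_of_completed hb (m := m) hτ hτ0 hlt (by linarith [t.2] : τ n ≤ τ n + t) ht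
    simp only [ENNReal.coe_toReal]
    linarith

end IsFBSchedule

end Schedule

/-! ### I.i.d. sequences, reversal of the past, and the monotone limit -/

/-- The sequence with first term `y` followed by the sequence `z`. -/
def cons (y : ℝ × ℝ) (z : ℕ → ℝ × ℝ) : ℕ → ℝ × ℝ
  | 0 => y
  | k + 1 => z k

@[simp] lemma cons_zero (y : ℝ × ℝ) (z : ℕ → ℝ × ℝ) : cons y z 0 = y := rfl
@[simp] lemma tail_cons (y : ℝ × ℝ) (z : ℕ → ℝ × ℝ) : tail (cons y z) = z := rfl

/-- The law of a sequence of independent pairs with law `μ`. -/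
noncomputable def seqLaw (μ : Measure (ℝ × ℝ)) [IsProbabilityMeasure μ] : Measure (ℕ → ℝ × ℝ) :=
  Measure.infinitePi fun _ => μ

instance (μ : Measure (ℝ × ℝ)) [IsProbabilityMeasure μ] : IsProbabilityMeasure (seqLaw μ) := by
  unfold seqLaw; infer_instance

@[fun_prop]
lemma measurable_tail : Measurable tail :=
  measurable_pi_lambda _ fun k => measurable_pi_apply (k + 1)

@[fun_prop]
lemma measurable_cons : Measurable fun q : (ℝ × ℝ) × (ℕ → ℝ × ℝ) => cons q.1 q.2 := by
  refine measurable_pi_lambda _ fun k => ?_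
  cases k with
  | zero => exact measurable_fst
  | succ k => exact (measurable_pi_apply k).comp measurable_snd

section Model

variable (μ : Measure (ℝ × ℝ)) [IsProbabilityMeasure μ]

/-- Splitting off the first term of an i.i.d. sequence; every first-step equation below rests on
this. -/
lemma measurePreserving_cons :
    MeasurePreserving (fun q : (ℝ × ℝ) × (ℕ → ℝ × ℝ) => cons q.1 q.2)
      (μ.prod (seqLaw μ)) (seqLaw μ) := by
  refine ⟨measurable_cons, Measure.eq_infinitePi _ fun s t ht => ?_⟩
  classical
  rw [Measure.map_apply measurable_cons (.pi s.countable_toSet fun i _ => ht i)]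
  set s' : Finset ℕ := s.preimage Nat.succ Nat.succ_injective.injOn with hs'
  set t0 : Set (ℝ × ℝ) := if 0 ∈ s then t 0 else Set.univ with ht0
  have hset : (fun q : (ℝ × ℝ) × (ℕ → ℝ × ℝ) => cons q.1 q.2) ⁻¹' ((s : Set ℕ).pi t) =
      t0 ×ˢ ((s' : Set ℕ).pi fun i => t (i + 1)) := by
    ext ⟨y, z⟩
    simp only [Set.mem_preimage, Set.mem_pi, Finset.mem_coe, Set.mem_prod, hs', ht0,
      Finset.mem_preimage]
    constructor
    · intro hh
      refine ⟨?_, fun i hi => hh (i + 1) hi⟩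
      split_ifs with h0
      · exact hh 0 h0
      · trivial
    · rintro ⟨h0, hh⟩ i hi
      cases i with
      | zero => simpa [hi] using h0
      | succ i => exact hh i hi
  rw [hset, Measure.prod_prod, seqLaw, Measure.infinitePi_pi _ fun i _ => ht _]
  have himg : s'.image Nat.succ = s.erase 0 := by
    ext i
    simp only [hs', Finset.mem_image, Finset.mem_preimage, Finset.mem_erase]
    constructor
    · rintro ⟨j, hj, rfl⟩; exact ⟨Nat.succ_ne_zero j, hj⟩
    · rintro ⟨hi, his⟩
      exact ⟨i - 1, by rwa [Nat.succ_eq_add_one, Nat.sub_add_cancel (Nat.pos_of_ne_zero hi)],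
        by omega⟩
  have hprod : ∏ i ∈ s', μ (t (i + 1)) = ∏ i ∈ s.erase 0, μ (t i) := by
    rw [← himg, Finset.prod_image fun _ _ _ _ h => Nat.succ_injective h]
  rw [hprod, ht0]
  split_ifs with h0
  · exact Finset.mul_prod_erase s (fun i => μ (t i)) h0
  · rw [measure_univ, one_mul, Finset.erase_eq_of_notMem h0]

lemma lintegral_seqLaw {f : (ℕ → ℝ × ℝ) → ℝ≥0∞} (hf : Measurable f) :
    ∫⁻ z, f z ∂(seqLaw μ) = ∫⁻ y, ∫⁻ z, f (cons y z) ∂(seqLaw μ) ∂μ := by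
  rw [← (measurePreserving_cons μ).lintegral_comp hf]
  exact lintegral_prod _ (hf.comp measurable_cons).aemeasurable

lemma ae_seqLaw {p : ℝ × ℝ → Prop} (hp : ∀ᵐ y ∂μ, p y) : ∀ᵐ z ∂(seqLaw μ), ∀ k, p (z k) :=
  ae_all_iff.2 fun k =>
    (measurePreserving_eval_infinitePi (fun _ => μ) k).quasiMeasurePreserving.ae hp

/-- The workload at time `0` if `n` customers arrived before, `p 0, p 1, …` being the pairs of the
service requirement and the following interarrival time, the most recent first. -/
noncomputable def pastWorkload (x : ℝ) : ℕ → (ℕ → ℝ × ℝ) → ℝ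
  | 0, _ => 0
  | n + 1, p => max (pastWorkload x n (tail p) + min (p 0).1 x - (p 0).2) 0

/-- The sequence consisting of `q.1 (n - 1), …, q.1 0` followed by `q.2`. -/
def assemble : ℕ → (ℕ → ℝ × ℝ) × (ℕ → ℝ × ℝ) → (ℕ → ℝ × ℝ)
  | 0, q => q.2
  | n + 1, q => assemble n (tail q.1, cons (q.1 0) q.2)

lemma assemble_add (n i : ℕ) (q : (ℕ → ℝ × ℝ) × (ℕ → ℝ × ℝ)) :
    assemble n q (n + i) = q.2 i := by
  induction n generalizing q i with
  | zero => simp [assemble]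
  | succ n ih => rw [assemble, show n + 1 + i = n + (i + 1) by omega, ih]; rfl

lemma workload_assemble (x : ℝ) (n : ℕ) (q : (ℕ → ℝ × ℝ) × (ℕ → ℝ × ℝ)) :
    workload x (assemble n q) n = pastWorkload x n q.1 := by
  induction n generalizing q with
  | zero => rfl
  | succ n ih =>
    have := assemble_add n 0 (tail q.1, cons (q.1 0) q.2)
    rw [add_zero] at this
    rw [workload, assemble, ih, pastWorkload, this]; rfl

/-- Moving the boundary between past and future by one customer does not change the law, as all the
pairs are i.i.d. -/
lemma measurePreserving_step :
    MeasurePreserving (fun q : (ℕ → ℝ × ℝ) × (ℕ → ℝ × ℝ) => (tail q.1, cons (q.1 0) q.2))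
      ((seqLaw μ).prod (seqLaw μ)) ((seqLaw μ).prod (seqLaw μ)) := by
  have h1 : MeasurePreserving
      (fun r : ((ℝ × ℝ) × (ℕ → ℝ × ℝ)) × (ℕ → ℝ × ℝ) => (cons r.1.1 r.1.2, r.2))
      ((μ.prod (seqLaw μ)).prod (seqLaw μ)) ((seqLaw μ).prod (seqLaw μ)) :=
    (measurePreserving_cons μ).prod (MeasurePreserving.id _)
  have h2 : MeasurePreserving
      (fun r : ((ℝ × ℝ) × (ℕ → ℝ × ℝ)) × (ℕ → ℝ × ℝ) => (r.1.2, cons r.1.1 r.2))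
      ((μ.prod (seqLaw μ)).prod (seqLaw μ)) ((seqLaw μ).prod (seqLaw μ)) := by
    have ha : MeasurePreserving (fun r : (ℝ × ℝ) × (ℕ → ℝ × ℝ) => (r.2, r.1))
        (μ.prod (seqLaw μ)) ((seqLaw μ).prod μ) := Measure.measurePreserving_swap
    have hb := ha.prod (MeasurePreserving.id (seqLaw μ))
    have hc := measurePreserving_prodAssoc (seqLaw μ) μ (seqLaw μ)
    have hd := (MeasurePreserving.id (seqLaw μ)).prod (measurePreserving_cons μ)
    exact hd.comp (hc.comp hb)
  refine ⟨by fun_prop, ?_⟩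
  conv_lhs => rw [← h1.map_eq, Measure.map_map (by fun_prop) h1.measurable]
  exact h2.map_eq

/-- Consequence: customer `n` of a forward sequence has the law of customer `0` preceded by `n`
others. All sojourn times thereby live on one space, where they can be compared pointwise. -/
lemma measurePreserving_assemble (n : ℕ) :
    MeasurePreserving (assemble n) ((seqLaw μ).prod (seqLaw μ)) (seqLaw μ) := by
  induction n with
  | zero => exact measurePreserving_snd
  | succ n ih => exact ih.comp (measurePreserving_step μ)

end Model

@[fun_prop]
lemma measurable_workload (n : ℕ) :
    Measurable fun r : ℝ × (ℕ → ℝ × ℝ) => workload r.1 r.2 n := by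
  induction n with
  | zero => exact measurable_const
  | succ n ih => simp only [workload]; fun_prop

@[fun_prop]
lemma measurable_pastWorkload (n : ℕ) :
    Measurable fun r : ℝ × (ℕ → ℝ × ℝ) => pastWorkload r.1 n r.2 := by
  induction n with
  | zero => exact measurable_const
  | succ n ih =>
    simp only [pastWorkload]
    have : Measurable fun r : ℝ × (ℕ → ℝ × ℝ) => pastWorkload r.1 n (tail r.2) :=
      ih.comp (measurable_fst.prodMk (measurable_tail.comp measurable_snd))
    fun_prop

@[fun_prop]
lemma measurable_busy (m : ℕ) :
    Measurable fun r : ℝ × ℝ × (ℕ → ℝ × ℝ) => busy r.1 m r.2.1 r.2.2 := by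
  induction m with
  | zero => simp only [busy]; fun_prop
  | succ m ih =>
    simp only [busy]
    have : Measurable fun r : ℝ × ℝ × (ℕ → ℝ × ℝ) =>
        busy r.1 m (r.2.1 + min (r.2.2 0).1 r.1 - (r.2.2 0).2) (tail r.2.2) :=
      ih.comp (by fun_prop : Measurable fun r : ℝ × ℝ × (ℕ → ℝ × ℝ) =>
        (r.1, r.2.1 + min (r.2.2 0).1 r.1 - (r.2.2 0).2, tail r.2.2))
    exact Measurable.ite (measurableSet_lt (by fun_prop) (by fun_prop)) (by fun_prop) (by fun_prop)

/-- The sojourn time of customer `n`, in terms of the service requirements and the interarrival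
times. -/
noncomputable def sojournOf (n : ℕ) (y : ℕ → ℝ × ℝ) : ℝ≥0∞ :=
  ⨆ m : ℕ, ENNReal.ofReal
    (busy (y n).1 (m + 1) (workload (y n).1 y n) fun i => y (n + i))

/-- The sojourn time of customer `0` of `q.2` if it is preceded by `n` customers with
requirements and interarrival times given by `q.1`. -/
noncomputable def pastSojourn (n : ℕ) (q : (ℕ → ℝ × ℝ) × (ℕ → ℝ × ℝ)) : ℝ≥0∞ :=
  ⨆ m : ℕ, ENNReal.ofReal (busy (q.2 0).1 (m + 1) (pastWorkload (q.2 0).1 n q.1) q.2)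

/-- The sojourn time of customer `0` if it is preceded by infinitely many customers. -/
noncomputable def limitSojourn (q : (ℕ → ℝ × ℝ) × (ℕ → ℝ × ℝ)) : ℝ≥0∞ :=
  ⨆ n : ℕ, pastSojourn n q

lemma measurable_sojournOf (n : ℕ) : Measurable (sojournOf n) := by
  refine Measurable.iSup fun m => ENNReal.measurable_ofReal.comp ?_
  have h1 : Measurable fun y : ℕ → ℝ × ℝ => workload (y n).1 y n :=
    (measurable_workload n).comp (by fun_prop : Measurable fun y : ℕ → ℝ × ℝ => ((y n).1, y))
  have h2 : Measurable fun y : ℕ → ℝ × ℝ => fun i => y (n + i) :=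
    measurable_pi_lambda _ fun i => measurable_pi_apply _
  exact (measurable_busy (m + 1)).comp (by fun_prop : Measurable fun y : ℕ → ℝ × ℝ =>
    ((y n).1, workload (y n).1 y n, fun i => y (n + i)))

lemma measurable_pastSojourn (n : ℕ) : Measurable (pastSojourn n) := by
  refine Measurable.iSup fun m => ENNReal.measurable_ofReal.comp ?_
  have h1 : Measurable fun q : (ℕ → ℝ × ℝ) × (ℕ → ℝ × ℝ) => pastWorkload (q.2 0).1 n q.1 :=
    (measurable_pastWorkload n).comp (by fun_prop :
      Measurable fun q : (ℕ → ℝ × ℝ) × (ℕ → ℝ × ℝ) => ((q.2 0).1, q.1))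
  exact (measurable_busy (m + 1)).comp (by fun_prop :
    Measurable fun q : (ℕ → ℝ × ℝ) × (ℕ → ℝ × ℝ) =>
      ((q.2 0).1, pastWorkload (q.2 0).1 n q.1, q.2))

lemma measurable_limitSojourn : Measurable limitSojourn :=
  Measurable.iSup measurable_pastSojourn

lemma sojournOf_assemble (n : ℕ) (q : (ℕ → ℝ × ℝ) × (ℕ → ℝ × ℝ)) :
    sojournOf n (assemble n q) = pastSojourn n q := by
  have h0 : assemble n q n = q.2 0 := assemble_add n 0 q
  simp only [sojournOf, pastSojourn, workload_assemble, h0, assemble_add]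

lemma pastWorkload_nonneg (x : ℝ) (n : ℕ) (p : ℕ → ℝ × ℝ) : 0 ≤ pastWorkload x n p := by
  cases n with
  | zero => exact le_rfl
  | succ n => exact le_max_right _ _

/-- Loynes' monotonicity: an earlier start from an empty queue can only increase the workload at
time `0`. -/
lemma pastWorkload_le_succ (x : ℝ) (n : ℕ) (p : ℕ → ℝ × ℝ) :
    pastWorkload x n p ≤ pastWorkload x (n + 1) p := by
  induction n generalizing p with
  | zero => exact pastWorkload_nonneg _ _ _
  | succ n ih =>
    rw [pastWorkload, pastWorkload]
    exact max_le_max_right _ (by linarith [ih (tail p)])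

section Positive

variable {x : ℝ} (hx : 0 ≤ x)
include hx

lemma le_busy (m : ℕ) {z : ℕ → ℝ × ℝ} (hz : ∀ k, 0 ≤ (z k).1) (v : ℝ) :
    v ≤ busy x m v z := by
  induction m generalizing v z with
  | zero => exact le_rfl
  | succ m ih =>
    have hz' : ∀ k, 0 ≤ (tail z k).1 := fun k => hz (k + 1)
    have h0 : 0 ≤ min (z 0).1 x := le_min (hz 0) hx
    rw [busy]
    split_ifs
    · linarith [ih hz' (v + min (z 0).1 x - (z 0).2)]
    · linarith

lemma busy_le_succ (m : ℕ) {z : ℕ → ℝ × ℝ} (hz : ∀ k, 0 ≤ (z k).1) (v : ℝ) :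
    busy x m v z ≤ busy x (m + 1) v z := by
  induction m generalizing v z with
  | zero => exact le_busy hx 1 hz v
  | succ m ih =>
    have hz' : ∀ k, 0 ≤ (tail z k).1 := fun k => hz (k + 1)
    rw [busy, busy]
    split_ifs
    · linarith [ih hz' (v + min (z 0).1 x - (z 0).2)]
    · exact le_rfl

lemma busy_mono (m : ℕ) {z : ℕ → ℝ × ℝ} (hz : ∀ k, 0 ≤ (z k).1) {v v' : ℝ} (hv : v ≤ v') :
    busy x m v z ≤ busy x m v' z := by
  induction m generalizing v v' z with
  | zero => exact hv
  | succ m ih =>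
    have hz' : ∀ k, 0 ≤ (tail z k).1 := fun k => hz (k + 1)
    rw [busy, busy]
    split_ifs with h1 h2 h2
    · linarith [ih hz' (show v + min (z 0).1 x - (z 0).2 ≤ v' + min (z 0).1 x - (z 0).2 by linarith)]
    · linarith
    · linarith [le_busy hx m hz' (v' + min (z 0).1 x - (z 0).2)]
    · linarith

end Positive

lemma pastSojourn_le_succ (n : ℕ) {q : (ℕ → ℝ × ℝ) × (ℕ → ℝ × ℝ)} (hq : ∀ k, 0 ≤ (q.2 k).1) :
    pastSojourn n q ≤ pastSojourn (n + 1) q :=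
  iSup_mono fun m => ENNReal.ofReal_le_ofReal
    (busy_mono (hq 0) (m + 1) hq (pastWorkload_le_succ _ _ _))

lemma ae_tendsto_limitSojourn (μ : Measure (ℝ × ℝ)) [IsProbabilityMeasure μ]
    (hμ : ∀ᵐ y ∂μ, 0 < y.1) :
    ∀ᵐ q ∂((seqLaw μ).prod (seqLaw μ)),
      Tendsto (fun n => pastSojourn n q) atTop (𝓝 (limitSojourn q)) := by
  have := (measurePreserving_snd (μ := seqLaw μ) (ν := seqLaw μ)).quasiMeasurePreserving.ae
    (ae_seqLaw _ hμ)
  filter_upwards [this] with q hq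
  exact tendsto_atTop_iSup (monotone_nat_of_le_succ fun n =>
    pastSojourn_le_succ n fun k => (hq k).le)

/-- The steady-state law of the sojourn time if `μ` is the common law of the pairs of a service
requirement and the following interarrival time. -/
noncomputable def limitLaw (μ : Measure (ℝ × ℝ)) [IsProbabilityMeasure μ] :
    ProbabilityMeasure ℝ≥0∞ :=
  ⟨((seqLaw μ).prod (seqLaw μ)).map limitSojourn,
    Measure.isProbabilityMeasure_map measurable_limitSojourn.aemeasurable⟩

lemma coe_limitLaw (μ : Measure (ℝ × ℝ)) [IsProbabilityMeasure μ] :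
    (limitLaw μ : Measure ℝ≥0∞) = ((seqLaw μ).prod (seqLaw μ)).map limitSojourn := rfl

/-! ### Existence of the steady-state sojourn law -/

section Queue

variable {Ω : Type*} [MeasurableSpace Ω] {P : Measure Ω} [IsProbabilityMeasure P]
  {lam : ℝ} {F : Measure ℝ} {A B : ℕ → Ω → ℝ} {S : ℕ → ℝ → Ω → ℝ}

lemma ae_pos_expMeasure (lam : ℝ) : ∀ᵐ x ∂(expMeasure lam), 0 < x := by
  rw [ae_iff]
  have : {x : ℝ | ¬ 0 < x} = Set.Iic 0 := by ext; simp
  rw [this, expMeasure, gammaMeasure, withDensity_apply _ measurableSet_Iic,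
    ← setLIntegral_congr Iio_ae_eq_Iic]
  exact lintegral_gammaPDF_of_nonpos le_rfl

namespace IsMGI1FB

variable [IsProbabilityMeasure F] [IsProbabilityMeasure (expMeasure lam)]
  (h : IsMGI1FB P lam F A B S)
include h

-- Customer `k` is paired with the gap `A (k + 1)` that follows its arrival; `A 0`, the time before
-- the first arrival, is dropped.
omit [IsProbabilityMeasure P] in
lemma hasLaw_pairs :
    HasLaw (fun ω k => (B k ω, A (k + 1) ω)) (seqLaw (F.prod (expMeasure lam))) P := by
  have hm : ∀ k : ℕ, AEMeasurable (fun ω => (B k ω, A (k + 1) ω)) P := fun k =>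
    (h.service_law k).aemeasurable.prodMk (h.interarrival_law (k + 1)).aemeasurable
  refine ⟨aemeasurable_pi_iff.2 hm, ?_⟩
  -- Selecting the variables by an injection on `ℕ × Bool` keeps independence; currying then groups
  -- them into a sequence of pairs.
  let g : ℕ × Bool → ℕ ⊕ ℕ := fun i => bif i.2 then Sum.inl (i.1 + 1) else Sum.inr i.1
  have hg : Function.Injective g := by
    rintro ⟨i, b⟩ ⟨j, c⟩ hij
    cases b <;> cases c <;> simp_all [g]
  let law : Bool → Measure ℝ := fun c => bif c then expMeasure lam else F
  have hlawP : ∀ c, IsProbabilityMeasure (law c) := by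
    intro c; cases c <;> simp only [law, cond_true, cond_false] <;> infer_instance
  have hlaw : ∀ i : ℕ × Bool, HasLaw (Sum.elim A B (g i)) (law i.2) P := by
    rintro ⟨i, c⟩
    cases c
    · exact h.service_law i
    · exact h.interarrival_law (i + 1)
  have key := ((h.indep.precomp hg).hasLaw_infinitePi hlaw
    (aemeasurable_pi_iff.2 fun i => (hlaw i).aemeasurable))
  have hcurry := Measure.infinitePi_map_curry (fun (_ : ℕ) (c : Bool) => law c)
  have hpi := Measure.infinitePi_map_pi (fun _ : ℕ => Measure.infinitePi law)
    (f := fun _ (r : Bool → ℝ) => (r false, r true)) (fun _ => by fun_prop)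
  have hpair : (Measure.infinitePi law).map (fun r => (r false, r true)) =
      F.prod (expMeasure lam) :=
    Measure.infinitePi_map_eval_prod (P := law) (by decide)
  simp_rw [hpair] at hpi
  rw [seqLaw, ← hpi, ← hcurry, ← key.map_eq,
    AEMeasurable.map_map_of_aemeasurable (by fun_prop) key.aemeasurable,
    AEMeasurable.map_map_of_aemeasurable (by fun_prop)
      ((MeasurableEquiv.measurable _).comp_aemeasurable key.aemeasurable)]
  rfl

-- The strong law is applied to the gaps cut off at 1, which are bounded, hence integrable, and have
-- a positive mean.
omit [IsProbabilityMeasure F] [IsProbabilityMeasure (expMeasure lam)] in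
lemma tendsto_arrivalTime :
    ∀ᵐ ω ∂P, Tendsto (arrivalTime fun n => A n ω) atTop atTop := by
  have hA : ∀ᵐ ω ∂P, ∀ k, 0 < A k ω := ae_all_iff.2 fun k =>
    (h.interarrival_law k).ae_iff (measurableSet_setOfPred.1 measurableSet_Ioi) |>.2
      (ae_pos_expMeasure lam)
  have hmin : Measurable fun x : ℝ => min x 1 := by fun_prop
  have hint : Integrable (fun ω => min (A 0 ω) 1) P := by
    refine Integrable.of_bound
      (hmin.comp_aemeasurable (h.interarrival_law 0).aemeasurable).aestronglyMeasurable 1 ?_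
    filter_upwards [hA] with ω hω
    rw [Real.norm_of_nonneg (le_min (hω 0).le zero_le_one)]
    exact min_le_right _ _
  have hindA : iIndepFun A P := iIndepFun.precomp (g := Sum.inl) Sum.inl_injective h.indep
  have hslln := strong_law_ae_real (fun k ω => min (A k ω) 1) hint
    (fun i j hij => (hindA.indepFun hij).comp hmin hmin)
    (fun i => IdentDistrib.comp ⟨(h.interarrival_law i).aemeasurable,
      (h.interarrival_law 0).aemeasurable,
      by rw [(h.interarrival_law i).map_eq, (h.interarrival_law 0).map_eq]⟩ hmin)
  have hpos : 0 < ∫ ω, min (A 0 ω) 1 ∂P := by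
    have hnn : 0 ≤ᵐ[P] fun ω => min (A 0 ω) 1 := by
      filter_upwards [hA] with ω hω using le_min (hω 0).le zero_le_one
    refine lt_of_le_of_ne (integral_nonneg_of_ae hnn) fun h0 => ?_
    have := (integral_eq_zero_iff_of_nonneg_ae hnn hint).1 h0.symm
    obtain ⟨ω, h1, h2⟩ := (this.and hA).exists
    exact absurd h1 (lt_min (h2 0) one_pos).ne'
  filter_upwards [hA, hslln] with ω hω hlim
  have h1 : Tendsto (fun n : ℕ => ∑ i ∈ Finset.range n, min (A i ω) 1) atTop atTop := by
    refine (hlim.pos_mul_atTop hpos tendsto_natCast_atTop_atTop).congr' ?_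
    filter_upwards [eventually_gt_atTop 0] with n hn
    field_simp
  refine tendsto_atTop_mono (fun n => ?_) (h1.comp (tendsto_add_atTop_nat 1))
  exact Finset.sum_le_sum fun i _ => min_le_left _ _

omit [IsProbabilityMeasure F] [IsProbabilityMeasure (expMeasure lam)] in
lemma sojourn_ae_eq (hF : ∀ᵐ x ∂F, 0 < x) (n : ℕ) :
    sojourn A B S n =ᵐ[P] fun ω => sojournOf n fun k => (B k ω, A (k + 1) ω) := by
  have hA : ∀ᵐ ω ∂P, ∀ k, 0 < A k ω := ae_all_iff.2 fun k =>
    (h.interarrival_law k).ae_iff (measurableSet_setOfPred.1 measurableSet_Ioi) |>.2 (ae_pos_expMeasure lam)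
  have hB : ∀ᵐ ω ∂P, ∀ k, 0 < B k ω := ae_all_iff.2 fun k =>
    (h.service_law k).ae_iff (measurableSet_setOfPred.1 measurableSet_Ioi) |>.2 hF
  filter_upwards [hA, hB, h.schedule, h.tendsto_arrivalTime] with ω hA hB hS hlim
  have hsub : ∀ k, arrivalTime (fun k => A k ω) (k + 1) - arrivalTime (fun k => A k ω) k
      = A (k + 1) ω := fun k => by
    rw [arrivalTime, arrivalTime, Finset.sum_range_succ _ (k + 1)]; ring
  have := hS.sojournTime_eq hB (strictMono_nat_of_lt_succ fun k => by linarith [hsub k, hA (k + 1)])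
    (by simpa [arrivalTime] using hA 0) hlim n
  simp only [hsub] at this
  exact this

/-- Sojourn `n` has the law of `pastSojourn n`, which converges almost surely; dominated convergence
for bounded continuous functions does the rest. The limit lives in `ℝ≥0∞`, so stability is needed
only later, for the mean. -/
theorem isSteadyState (hF : ∀ᵐ x ∂F, 0 < x) :
    IsSteadyStateSojournLaw P A B S (limitLaw (F.prod (expMeasure lam))) := by
  set Q := seqLaw (F.prod (expMeasure lam)) with hQ
  have hmeas : ∀ n, AEMeasurable (sojourn A B S n) P := fun n =>
    ((measurable_sojournOf n).comp_aemeasurable h.hasLaw_pairs.aemeasurable).congr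
      (h.sojourn_ae_eq hF n).symm
  have hmap : ∀ n, P.map (sojourn A B S n) = (Q.prod Q).map (pastSojourn n) := fun n => by
    have e : pastSojourn n = sojournOf n ∘ assemble n :=
      funext fun q => (sojournOf_assemble n q).symm
    rw [Measure.map_congr (h.sojourn_ae_eq hF n), e,
      ← Measure.map_map (measurable_sojournOf n) (measurePreserving_assemble (F.prod (expMeasure lam)) n).measurable,
      (measurePreserving_assemble (F.prod (expMeasure lam)) n).map_eq, ← h.hasLaw_pairs.map_eq,
      AEMeasurable.map_map_of_aemeasurable (measurable_sojournOf n).aemeasurable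
        h.hasLaw_pairs.aemeasurable]
    rfl
  refine ⟨hmeas, aemeasurable_id, ?_⟩
  refine ProbabilityMeasure.tendsto_iff_forall_integral_tendsto.2 fun f => ?_
  simp only [ProbabilityMeasure.coe_mk, hmap, Measure.map_id, coe_limitLaw]
  rw [integral_map measurable_limitSojourn.aemeasurable f.continuous.aestronglyMeasurable]
  simp_rw [fun n => integral_map (μ := Q.prod Q) (measurable_pastSojourn n).aemeasurable
    f.continuous.aestronglyMeasurable]
  refine tendsto_integral_of_dominated_convergence (fun _ => ‖f‖)
    (fun n => (f.continuous.measurable.comp (measurable_pastSojourn n)).aestronglyMeasurable)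
    (integrable_const _) (fun n => Eventually.of_forall fun q => f.norm_coe_le_norm _) ?_
  filter_upwards [ae_tendsto_limitSojourn (F.prod (expMeasure lam))
    (measurePreserving_fst.quasiMeasurePreserving.ae hF)] with q hq
  exact (f.continuous.tendsto _).comp hq

end IsMGI1FB

end Queue

/-! ### First-step integrals against the exponential law -/

section Exponential

variable {lam : ℝ} (hlam : 0 < lam)
include hlam

omit hlam in
lemma lintegral_expMeasure {f : ℝ → ℝ≥0∞} (hf : Measurable f) :
    ∫⁻ a, f a ∂(expMeasure lam) =
      ∫⁻ a in Set.Ioi 0, ENNReal.ofReal (lam * Real.exp (-(lam * a))) * f a := by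
  have hpdf : expMeasure lam = volume.withDensity (exponentialPDF lam) := rfl
  have hm : Measurable (exponentialPDF lam) :=
    (measurable_exponentialPDFReal lam).ennreal_ofReal
  rw [hpdf, lintegral_withDensity_eq_lintegral_mul _ hm hf, ← setLIntegral_univ,
    ← Set.Iic_union_Ioi (a := (0 : ℝ)), lintegral_union measurableSet_Ioi
      (Set.Iic_disjoint_Ioi le_rfl), ← setLIntegral_congr Iio_ae_eq_Iic,
    setLIntegral_congr_fun (g := fun _ => 0) measurableSet_Iio, lintegral_zero, zero_add]
  · refine setLIntegral_congr_fun measurableSet_Ioi fun a ha => ?_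
    simp only [Pi.mul_apply, exponentialPDF_of_nonneg (le_of_lt ha)]
  · intro a ha
    simp only [Pi.mul_apply, exponentialPDF_of_neg ha, zero_mul]

/-- Integration against the exponential law on `[0, w)`, if an antiderivative is known. -/
lemma setLIntegral_expMeasure_Iio {w : ℝ} (hw : 0 ≤ w) {g G : ℝ → ℝ} (hg : Continuous g)
    (hg0 : ∀ a ∈ Set.Icc 0 w, 0 ≤ g a)
    (hG : ∀ a, HasDerivAt (fun a => -(Real.exp (-(lam * a)) * G a))
      (lam * Real.exp (-(lam * a)) * g a) a) :
    ∫⁻ a in Set.Iio w, ENNReal.ofReal (g a) ∂(expMeasure lam) =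
      ENNReal.ofReal (G 0 - Real.exp (-(lam * w)) * G w) := by
  rw [← lintegral_indicator measurableSet_Iio, lintegral_expMeasure (lam := lam)
    ((hg.measurable.ennreal_ofReal).indicator measurableSet_Iio)]
  have h1 : ∀ a, ENNReal.ofReal (lam * Real.exp (-(lam * a))) *
      (Set.Iio w).indicator (fun a => ENNReal.ofReal (g a)) a =
      (Set.Iio w).indicator (fun a => ENNReal.ofReal (lam * Real.exp (-(lam * a)) * g a)) a := by
    intro a
    by_cases ha : a ∈ Set.Iio w
    · rw [Set.indicator_of_mem ha, Set.indicator_of_mem ha, ← ENNReal.ofReal_mul (by positivity)]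
    · simp [Set.indicator_of_notMem ha]
  simp_rw [h1]
  have hcont : Continuous fun a => lam * Real.exp (-(lam * a)) * g a := by fun_prop
  rw [setLIntegral_indicator measurableSet_Iio, Set.inter_comm, Set.Ioi_inter_Iio,
    ← ofReal_integral_eq_lintegral_ofReal
      ((hcont.integrableOn_Icc (a := 0) (b := w)).mono_set Set.Ioo_subset_Icc_self)]
  · rw [← integral_Ioc_eq_integral_Ioo, ← intervalIntegral.integral_of_le hw,
      intervalIntegral.integral_eq_sub_of_hasDerivAt (fun a _ => hG a)
        (hcont.intervalIntegrable _ _)]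
    congr 1
    simp
    ring
  · refine (ae_restrict_iff' measurableSet_Ioo).2 (Eventually.of_forall fun a ha => ?_)
    exact mul_nonneg (by positivity) (hg0 a ⟨ha.1.le, ha.2.le⟩)

lemma expMeasure_Ici [IsProbabilityMeasure (expMeasure lam)] {w : ℝ} (hw : 0 ≤ w) :
    expMeasure lam (Set.Ici w) = ENNReal.ofReal (Real.exp (-(lam * w))) := by
  have h1 := setLIntegral_expMeasure_Iio hlam hw (g := fun _ => 1) (G := fun _ => 1)
    continuous_const (fun _ _ => zero_le_one) fun a => by
      simpa using hasDerivAt_neg_exp_mul_exp (r := lam) (x := a)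
  simp only [ENNReal.ofReal_one, lintegral_const, one_mul, mul_one, Measure.restrict_apply_univ] at h1
  rw [← Set.compl_Iio, prob_compl_eq_one_sub measurableSet_Iio, h1, ← ENNReal.ofReal_one,
    ← ENNReal.ofReal_sub _ (by simp [mul_nonneg hlam.le hw])]
  congr 1; ring

lemma lintegral_expMeasure_ite [IsProbabilityMeasure (expMeasure lam)] {w : ℝ} (hw : 0 ≤ w)
    {g G : ℝ → ℝ} (hg : Continuous g) (hg0 : ∀ a ∈ Set.Icc 0 w, 0 ≤ g a)
    (hG : ∀ a, HasDerivAt (fun a => -(Real.exp (-(lam * a)) * G a))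
      (lam * Real.exp (-(lam * a)) * g a) a)
    (hG0 : 0 ≤ G 0 - Real.exp (-(lam * w)) * G w) {d : ℝ} (hd : 0 ≤ d) :
    ∫⁻ a, (if a < w then ENNReal.ofReal (g a) else ENNReal.ofReal d) ∂(expMeasure lam) =
      ENNReal.ofReal (G 0 - Real.exp (-(lam * w)) * G w + d * Real.exp (-(lam * w))) := by
  have e1 : Set.EqOn (fun a => if a < w then ENNReal.ofReal (g a) else ENNReal.ofReal d)
      (fun a => ENNReal.ofReal (g a)) (Set.Iio w) := fun a ha => if_pos ha
  have e2 : Set.EqOn (fun a => if a < w then ENNReal.ofReal (g a) else ENNReal.ofReal d)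
      (fun _ => ENNReal.ofReal d) (Set.Iio w)ᶜ := fun a ha => if_neg ha
  rw [← lintegral_add_compl _ (measurableSet_Iio (a := w)),
    setLIntegral_congr_fun measurableSet_Iio e1,
    setLIntegral_congr_fun measurableSet_Iio.compl e2,
    setLIntegral_expMeasure_Iio hlam hw hg hg0 hG, setLIntegral_const, Set.compl_Iio,
    expMeasure_Ici hlam hw, ← ENNReal.ofReal_mul hd, ← ENNReal.ofReal_add hG0 (by positivity)]

lemma lintegral_expMeasure_exp_neg {θ : ℝ} (hθ : 0 < θ) :
    ∫⁻ a, ENNReal.ofReal (Real.exp (-(θ * a))) ∂(expMeasure lam) =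
      ENNReal.ofReal (lam / (lam + θ)) := by
  have hpos : 0 < lam + θ := by linarith
  have := isProbabilityMeasure_expMeasure hpos
  have h1 : ∫⁻ a, 1 ∂(expMeasure (lam + θ)) = 1 := by simp
  rw [lintegral_expMeasure measurable_const] at h1
  rw [lintegral_expMeasure (lam := lam) (by fun_prop)]
  -- Exponential tilting: the integrand is a multiple of the density of the exponential law with
  -- rate `lam + θ`.
  calc _ = ∫⁻ a in Set.Ioi 0, ENNReal.ofReal (lam / (lam + θ)) *
        (ENNReal.ofReal ((lam + θ) * Real.exp (-((lam + θ) * a))) * 1) := by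
        refine lintegral_congr fun a => ?_
        rw [mul_one, ← ENNReal.ofReal_mul (by positivity), ← ENNReal.ofReal_mul (by positivity)]
        congr 1
        rw [show -((lam + θ) * a) = -(lam * a) + -(θ * a) by ring, Real.exp_add]
        field_simp
    _ = _ := by rw [lintegral_const_mul _ (by fun_prop), h1, mul_one]

/-- The expectation of `(w - a)⁺² + (2 / lam) (w - a)⁺` for an exponential variable `a`. -/
lemma lintegral_expMeasure_sq_posPart [IsProbabilityMeasure (expMeasure lam)] {w : ℝ}
    (hw : 0 ≤ w) :
    ∫⁻ a, (ENNReal.ofReal ((max (w - a) 0) ^ 2) +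
        ENNReal.ofReal (2 / lam) * ENNReal.ofReal (max (w - a) 0)) ∂(expMeasure lam) =
      ENNReal.ofReal (w ^ 2) := by
  -- The coefficient `2 / lam` makes `-exp (-lam a) (w - a)²` an exact antiderivative, and it
  -- vanishes at `a = w`.
  have h := lintegral_expMeasure_ite hlam hw (g := fun a => (w - a) ^ 2 + 2 / lam * (w - a))
    (G := fun a => (w - a) ^ 2) (by fun_prop)
    (fun a ha => add_nonneg (sq_nonneg _)
      (mul_nonneg (by positivity) (sub_nonneg.2 ha.2))) (fun a => ?_) (by simp; positivity) le_rfl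
  · simp only [sub_zero, sub_self, zero_mul, add_zero, ENNReal.ofReal_zero, ne_eq,
      OfNat.ofNat_ne_zero, not_false_eq_true, zero_pow, mul_zero] at h
    rw [← h]
    refine lintegral_congr fun a => ?_
    split_ifs with ha
    · rw [max_eq_left (by linarith), ENNReal.ofReal_add (by positivity)
        (mul_nonneg (by positivity) (by linarith)), ENNReal.ofReal_mul (by positivity)]
    · rw [max_eq_right (by linarith)]; simp
  · have h1 : HasDerivAt (fun a => Real.exp (-(lam * a))) (Real.exp (-(lam * a)) * (-lam)) a := by
      simpa using ((hasDerivAt_id a).const_mul lam).neg.exp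
    have h2 : HasDerivAt (fun a => (w - a) ^ 2) (2 * (w - a) * (-1)) a := by
      simpa using ((hasDerivAt_id a).const_sub w).fun_pow 2
    refine ((h1.mul h2).neg).congr_deriv ?_
    field_simp
    ring

/-- The first-step equation for the mean length of a busy period. -/
lemma lintegral_expMeasure_busy [IsProbabilityMeasure (expMeasure lam)] {w K : ℝ}
    (hw : 0 ≤ w) (hK : 1 ≤ K) :
    ∫⁻ a, (if a < w then ENNReal.ofReal (a + K * (w - a) + (K - 1) / lam)
      else ENNReal.ofReal w) ∂(expMeasure lam) = ENNReal.ofReal (K * w) := by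
  have hg0 : ∀ a ∈ Set.Icc 0 w, 0 ≤ a + K * (w - a) + (K - 1) / lam := fun a ha => by
    have h1 := ha.1
    have h2 : 0 ≤ K * (w - a) := mul_nonneg (by linarith) (sub_nonneg.2 ha.2)
    have h3 : 0 ≤ (K - 1) / lam := div_nonneg (by linarith) hlam.le
    positivity
  -- Here `G a = a + K (w - a)`; its derivative `-(K - 1)` accounts for the extra `(K - 1) / lam` in
  -- the integrand.
  have hG : ∀ a, HasDerivAt (fun a => -(Real.exp (-(lam * a)) * (K * w - (K - 1) * a)))
      (lam * Real.exp (-(lam * a)) * (a + K * (w - a) + (K - 1) / lam)) a := fun a => by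
    have h1 : HasDerivAt (fun a => Real.exp (-(lam * a))) (Real.exp (-(lam * a)) * (-lam)) a := by
      simpa using ((hasDerivAt_id a).const_mul lam).neg.exp
    have h2 : HasDerivAt (fun a => K * w - (K - 1) * a) (-(K - 1)) a := by
      simpa using ((hasDerivAt_id a).const_mul (K - 1)).const_sub (K * w)
    refine ((h1.mul h2).neg).congr_deriv ?_
    field_simp
    ring
  rw [lintegral_expMeasure_ite hlam hw (by fun_prop) hg0 hG ?_ hw]
  · congr 1; ring
  · have h1 : Real.exp (-(lam * w)) ≤ 1 := by simp [mul_nonneg hlam.le hw]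
    have h2 : 0 ≤ w * (1 - Real.exp (-(lam * w))) := mul_nonneg hw (by linarith)
    have h3 : 0 ≤ (K - 1) * w := mul_nonneg (by linarith) hw
    nlinarith

end Exponential

/-! ### Truncated moments and an exponential contraction -/

/-- The mean of the service requirement truncated at `x`. -/
noncomputable def truncMean (F : Measure ℝ) (x : ℝ) : ℝ := ∫ b, min b x ∂F

/-- The second moment of the service requirement truncated at `x`. -/
noncomputable def truncSq (F : Measure ℝ) (x : ℝ) : ℝ := ∫ b, min b x ^ 2 ∂F

section Truncated

variable {F : Measure ℝ} [IsProbabilityMeasure F] (hF : ∀ᵐ b ∂F, 0 < b) {x : ℝ} (hx : 0 < x)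
include hF hx

lemma integrable_min_pow (k : ℕ) : Integrable (fun b => min b x ^ k) F := by
  refine Integrable.of_bound (by fun_prop) (x ^ k) ?_
  filter_upwards [hF] with b hb
  have h0 : 0 ≤ min b x := le_min hb.le hx.le
  rw [Real.norm_of_nonneg (pow_nonneg h0 k)]
  exact pow_le_pow_left₀ h0 (min_le_right _ _) k

lemma integrable_min : Integrable (fun b => min b x) F := by
  simpa using integrable_min_pow hF hx 1

omit [IsProbabilityMeasure F] in
lemma truncMean_nonneg : 0 ≤ truncMean F x :=
  integral_nonneg_of_ae (by filter_upwards [hF] with b hb using le_min hb.le hx.le)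

omit [IsProbabilityMeasure F] hF hx in
lemma truncSq_nonneg (F : Measure ℝ) (x : ℝ) : 0 ≤ truncSq F x :=
  integral_nonneg fun _ => sq_nonneg _

lemma lintegral_min : ∫⁻ b, ENNReal.ofReal (min b x) ∂F = ENNReal.ofReal (truncMean F x) :=
  (ofReal_integral_eq_lintegral_ofReal (integrable_min hF hx)
    (by filter_upwards [hF] with b hb using le_min hb.le hx.le)).symm

lemma lintegral_min_sq :
    ∫⁻ b, ENNReal.ofReal (min b x ^ 2) ∂F = ENNReal.ofReal (truncSq F x) :=
  (ofReal_integral_eq_lintegral_ofReal (integrable_min_pow hF hx 2)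
    (Eventually.of_forall fun _ => sq_nonneg _)).symm

/-- The increment `min b x - a` has negative mean and is bounded above, so a small exponential
moment is below 1. This bounds all moments of the workload uniformly and makes the error in the busy
period iteration decay geometrically. -/
lemma exists_exp_moment {lam : ℝ} (hlam : 0 < lam) (hload : lam * truncMean F x < 1) :
    ∃ θ > 0, ∃ q, 0 ≤ q ∧ q < 1 ∧ ∀ v : ℝ,
      ∫⁻ b, ∫⁻ a, ENNReal.ofReal (Real.exp (θ * (v + min b x - a))) ∂(expMeasure lam) ∂F
        ≤ ENNReal.ofReal (q * Real.exp (θ * v)) := by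
  set m := truncMean F x with hm
  have hm0 : 0 ≤ m := truncMean_nonneg hF hx
  -- The first bound gives `θ c ≤ 1` for `c ≤ x`, so that `exp u ≤ 1 + u + u²` applies. The second
  -- gives `1 + θ m + θ² x² < (lam + θ) / lam`, which is `q < 1`.
  set θ := min (1 / x) ((1 - lam * m) / (2 * lam * x ^ 2)) with hθdef
  have hθ : 0 < θ := lt_min (by positivity) (div_pos (by linarith) (by positivity))
  have hθ1 : θ * x ≤ 1 := by
    have := min_le_left (1 / x) ((1 - lam * m) / (2 * lam * x ^ 2))
    calc θ * x ≤ 1 / x * x := by gcongr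
      _ = 1 := by field_simp
  have hθ2 : θ * (2 * lam * x ^ 2) ≤ 1 - lam * m := by
    have := min_le_right (1 / x) ((1 - lam * m) / (2 * lam * x ^ 2))
    rwa [← hθdef, le_div_iff₀ (by positivity)] at this
  have hexp : ∀ c, 0 ≤ c → c ≤ x → Real.exp (θ * c) ≤ 1 + θ * c + θ ^ 2 * x ^ 2 := by
    intro c hc hcx
    have h0 : 0 ≤ θ * c := by positivity
    have h1 : θ * c ≤ 1 := (mul_le_mul_of_nonneg_left hcx hθ.le).trans hθ1
    have h2 := Real.abs_exp_sub_one_sub_id_le (by rwa [abs_of_nonneg h0] : |θ * c| ≤ 1)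
    have h3 : (θ * c) ^ 2 ≤ (θ * x) ^ 2 := by gcongr
    have := (abs_le.1 h2).2
    nlinarith
  have hc : ∫⁻ b, ENNReal.ofReal (Real.exp (θ * min b x)) ∂F
      ≤ ENNReal.ofReal (1 + θ * m + θ ^ 2 * x ^ 2) := by
    have hint : Integrable (fun b => 1 + θ * min b x + θ ^ 2 * x ^ 2) F :=
      ((integrable_const _).add ((integrable_min hF hx).const_mul θ)).add (integrable_const _)
    have hval : ∫ b, (1 + θ * min b x + θ ^ 2 * x ^ 2) ∂F = 1 + θ * m + θ ^ 2 * x ^ 2 := by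
      have h1 : Integrable (fun b => 1 + θ * min b x) F :=
        (integrable_const _).add ((integrable_min hF hx).const_mul θ)
      rw [integral_add h1 (integrable_const _), integral_add (integrable_const _)
        ((integrable_min hF hx).const_mul θ), integral_const_mul]
      simp [hm, truncMean]
    rw [← hval, ofReal_integral_eq_lintegral_ofReal hint]
    · refine lintegral_mono_ae ?_
      filter_upwards [hF] with b hb
      exact ENNReal.ofReal_le_ofReal (hexp _ (le_min hb.le hx.le) (min_le_right _ _))
    · filter_upwards [hF] with b hb
      have : 0 ≤ min b x := le_min hb.le hx.le
      show 0 ≤ 1 + θ * min b x + θ ^ 2 * x ^ 2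
      positivity
  refine ⟨θ, hθ, (1 + θ * m + θ ^ 2 * x ^ 2) * (lam / (lam + θ)), by positivity, ?_, fun v => ?_⟩
  · rw [← mul_div_assoc, div_lt_one (by positivity)]
    nlinarith [mul_pos hθ (show 0 < 1 - lam * m by linarith),
      mul_le_mul_of_nonneg_left hθ2 hθ.le]
  · have h1 : ∀ b a : ℝ, ENNReal.ofReal (Real.exp (θ * (v + min b x - a))) =
        ENNReal.ofReal (Real.exp (θ * v)) * ENNReal.ofReal (Real.exp (θ * min b x)) *
          ENNReal.ofReal (Real.exp (-(θ * a))) := fun b a => by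
      rw [← ENNReal.ofReal_mul (by positivity), ← ENNReal.ofReal_mul (by positivity),
        ← Real.exp_add, ← Real.exp_add]
      congr 2; ring
    simp_rw [h1]
    calc _ = ∫⁻ b, ENNReal.ofReal (Real.exp (θ * v)) * ENNReal.ofReal (Real.exp (θ * min b x)) *
          ENNReal.ofReal (lam / (lam + θ)) ∂F := by
          refine lintegral_congr fun b => ?_
          rw [lintegral_const_mul _ (by fun_prop), lintegral_expMeasure_exp_neg hlam hθ]
      _ = ENNReal.ofReal (Real.exp (θ * v)) *
          (∫⁻ b, ENNReal.ofReal (Real.exp (θ * min b x)) ∂F) *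
            ENNReal.ofReal (lam / (lam + θ)) := by
          rw [lintegral_mul_const _ (by fun_prop), lintegral_const_mul _ (by fun_prop)]
      _ ≤ ENNReal.ofReal (Real.exp (θ * v)) * ENNReal.ofReal (1 + θ * m + θ ^ 2 * x ^ 2) *
            ENNReal.ofReal (lam / (lam + θ)) := by gcongr
      _ = _ := by
          rw [← ENNReal.ofReal_mul (by positivity), ← ENNReal.ofReal_mul (by positivity)]
          congr 1; ring

end Truncated

/-! ### Mean workload: the Pollaczek–Khinchine formula -/

section Workload

variable {lam : ℝ} {F : Measure ℝ} [IsProbabilityMeasure F] [IsProbabilityMeasure (expMeasure lam)]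

lemma measurable_pastWorkload_right (x : ℝ) (n : ℕ) : Measurable (pastWorkload x n) :=
  (measurable_pastWorkload n).comp (measurable_const.prodMk measurable_id)

/-- The expectation of a function of the workload, in terms of the workload one customer before. -/
lemma lintegral_pastWorkload_succ (x : ℝ) (n : ℕ) {f : ℝ → ℝ≥0∞} (hf : Measurable f) :
    ∫⁻ p, f (pastWorkload x (n + 1) p) ∂(seqLaw (F.prod (expMeasure lam))) =
      ∫⁻ p, ∫⁻ b, ∫⁻ a, f (max (pastWorkload x n p + min b x - a) 0)
        ∂(expMeasure lam) ∂F ∂(seqLaw (F.prod (expMeasure lam))) := by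
  have hm := measurable_pastWorkload_right x n
  rw [lintegral_seqLaw _ (f := fun p => f (pastWorkload x (n + 1) p))
    (hf.comp (measurable_pastWorkload_right x (n + 1)))]
  simp only [pastWorkload, cons_zero, tail_cons]
  rw [lintegral_lintegral_swap (by fun_prop)]
  refine lintegral_congr fun p => ?_
  rw [lintegral_prod _ (by fun_prop)]

variable (hlam : 0 < lam) (hF : ∀ᵐ b ∂F, 0 < b) {x : ℝ} (hx : 0 < x)

/-- The mean workload after `n` customers. -/
noncomputable def meanWorkload (lam : ℝ) (F : Measure ℝ) [IsProbabilityMeasure F]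
    [IsProbabilityMeasure (expMeasure lam)] (x : ℝ) (n : ℕ) : ℝ≥0∞ :=
  ∫⁻ p, ENNReal.ofReal (pastWorkload x n p) ∂(seqLaw (F.prod (expMeasure lam)))

/-- The second moment of the workload after `n` customers. -/
noncomputable def sqWorkload (lam : ℝ) (F : Measure ℝ) [IsProbabilityMeasure F]
    [IsProbabilityMeasure (expMeasure lam)] (x : ℝ) (n : ℕ) : ℝ≥0∞ :=
  ∫⁻ p, ENNReal.ofReal (pastWorkload x n p ^ 2) ∂(seqLaw (F.prod (expMeasure lam)))

lemma meanWorkload_mono (x : ℝ) : Monotone (meanWorkload lam F x) :=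
  monotone_nat_of_le_succ fun n => lintegral_mono fun p =>
    ENNReal.ofReal_le_ofReal (pastWorkload_le_succ x n p)

lemma sqWorkload_mono (x : ℝ) : Monotone (sqWorkload lam F x) :=
  monotone_nat_of_le_succ fun n => lintegral_mono fun p =>
    ENNReal.ofReal_le_ofReal (pow_le_pow_left₀ (pastWorkload_nonneg x n p)
      (pastWorkload_le_succ x n p) 2)

-- Test Lindley's recursion against `w² + (2 / lam) w`: averaging its positive part over an
-- exponential gap returns an exact square, so the reflection at zero leaves no error term.
include hlam hF hx in
lemma sqWorkload_succ (n : ℕ) :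
    sqWorkload lam F x (n + 1) + ENNReal.ofReal (2 / lam) * meanWorkload lam F x (n + 1) =
      sqWorkload lam F x n + ENNReal.ofReal (2 * truncMean F x) * meanWorkload lam F x n +
        ENNReal.ofReal (truncSq F x) := by
  have hm := measurable_pastWorkload_right x n
  have hm' := measurable_pastWorkload_right x (n + 1)
  rw [sqWorkload, meanWorkload, ← lintegral_const_mul _ (by fun_prop),
    ← lintegral_add_left (by fun_prop),
    lintegral_pastWorkload_succ x n (f := fun w => ENNReal.ofReal (w ^ 2) +
      ENNReal.ofReal (2 / lam) * ENNReal.ofReal w) (by fun_prop)]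
  have h1 : ∀ p, ∫⁻ b, ∫⁻ a, (ENNReal.ofReal ((max (pastWorkload x n p + min b x - a) 0) ^ 2) +
      ENNReal.ofReal (2 / lam) * ENNReal.ofReal (max (pastWorkload x n p + min b x - a) 0))
      ∂(expMeasure lam) ∂F = ENNReal.ofReal (pastWorkload x n p ^ 2) +
        ENNReal.ofReal (2 * truncMean F x) * ENNReal.ofReal (pastWorkload x n p) +
        ENNReal.ofReal (truncSq F x) := by
    intro p
    have hp := pastWorkload_nonneg x n p
    set w := pastWorkload x n p
    have h2 : ∀ᵐ b ∂F, ∫⁻ a, (ENNReal.ofReal ((max (w + min b x - a) 0) ^ 2) +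
        ENNReal.ofReal (2 / lam) * ENNReal.ofReal (max (w + min b x - a) 0)) ∂(expMeasure lam) =
        ENNReal.ofReal (w ^ 2) + ENNReal.ofReal (2 * w) * ENNReal.ofReal (min b x) +
          ENNReal.ofReal (min b x ^ 2) := by
      filter_upwards [hF] with b hb
      have hc : 0 ≤ min b x := le_min hb.le hx.le
      rw [lintegral_expMeasure_sq_posPart hlam (by positivity),
        ← ENNReal.ofReal_mul (by positivity), ← ENNReal.ofReal_add (by positivity) (by positivity),
        ← ENNReal.ofReal_add (by positivity) (by positivity)]
      congr 1; ring
    rw [lintegral_congr_ae h2, lintegral_add_right _ (by fun_prop),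
      lintegral_add_left (by fun_prop), lintegral_const_mul _ (by fun_prop),
      lintegral_min hF hx, lintegral_min_sq hF hx]
    have := truncMean_nonneg hF hx
    rw [← ENNReal.ofReal_mul (by positivity), ← ENNReal.ofReal_mul (by positivity)]
    simp only [lintegral_const, measure_univ, mul_one]
    congr 3; ring
  simp_rw [h1]
  rw [lintegral_add_right _ (by fun_prop), lintegral_add_left (by fun_prop),
    lintegral_const_mul _ (by fun_prop)]
  simp [sqWorkload, meanWorkload]

/-- Since `exp (θ max u 0) ≤ 1 + exp (θ u)`, each customer maps a bound `c` to `1 + q c`, whose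
fixed point is `1 / (1 - q)`. -/
lemma lintegral_exp_pastWorkload_le {θ q : ℝ} (hq0 : 0 ≤ q) (hq1 : q < 1)
    (hq : ∀ v : ℝ,
      ∫⁻ b, ∫⁻ a, ENNReal.ofReal (Real.exp (θ * (v + min b x - a))) ∂(expMeasure lam) ∂F
        ≤ ENNReal.ofReal (q * Real.exp (θ * v))) (n : ℕ) :
    ∫⁻ p, ENNReal.ofReal (Real.exp (θ * pastWorkload x n p)) ∂(seqLaw (F.prod (expMeasure lam)))
      ≤ ENNReal.ofReal (1 / (1 - q)) := by
  have hq' : 0 < 1 - q := by linarith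
  induction n with
  | zero =>
    simp only [pastWorkload, mul_zero, Real.exp_zero, lintegral_const, measure_univ, mul_one]
    refine ENNReal.ofReal_le_ofReal ?_
    rw [le_div_iff₀ hq']
    linarith
  | succ n ih =>
    have hm := measurable_pastWorkload_right x n
    rw [lintegral_pastWorkload_succ x n (f := fun w => ENNReal.ofReal (Real.exp (θ * w)))
      (by fun_prop)]
    calc _ ≤ ∫⁻ p, (1 + ENNReal.ofReal q * ENNReal.ofReal (Real.exp (θ * pastWorkload x n p)))
          ∂(seqLaw (F.prod (expMeasure lam))) := by
          refine lintegral_mono fun p => ?_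
          rw [← ENNReal.ofReal_mul hq0]
          refine le_trans ?_ (add_le_add_right (hq (pastWorkload x n p)) 1)
          calc _ ≤ ∫⁻ b, ∫⁻ a, (1 + ENNReal.ofReal
                (Real.exp (θ * (pastWorkload x n p + min b x - a)))) ∂(expMeasure lam) ∂F := by
                refine lintegral_mono fun b => lintegral_mono fun a => ?_
                rcases le_total (pastWorkload x n p + min b x - a) 0 with h | h
                · rw [max_eq_right h]; simp
                · rw [max_eq_left h]; exact le_add_self
            _ = _ := by
                simp_rw [fun b => lintegral_add_left (μ := expMeasure lam)
                  (measurable_const (a := (1 : ℝ≥0∞))) (fun a => ENNReal.ofReal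
                  (Real.exp (θ * (pastWorkload x n p + min b x - a))))]
                rw [lintegral_add_left (by fun_prop)]
                simp
      _ = 1 + ENNReal.ofReal q * ∫⁻ p, ENNReal.ofReal (Real.exp (θ * pastWorkload x n p))
          ∂(seqLaw (F.prod (expMeasure lam))) := by
          rw [lintegral_add_left (by fun_prop), lintegral_const_mul _ (by fun_prop)]
          simp
      _ ≤ 1 + ENNReal.ofReal q * ENNReal.ofReal (1 / (1 - q)) := by gcongr
      _ = ENNReal.ofReal (1 / (1 - q)) := by
          rw [← ENNReal.ofReal_mul hq0, ← ENNReal.ofReal_one,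
            ← ENNReal.ofReal_add zero_le_one (by positivity)]
          congr 1
          field_simp
          ring

include hlam hF hx in
/-- The Pollaczek–Khinchine formula for the mean workload. -/
theorem iSup_meanWorkload (hload : lam * truncMean F x < 1) :
    ⨆ n, meanWorkload lam F x n =
      ENNReal.ofReal (lam * truncSq F x / (2 * (1 - lam * truncMean F x))) := by
  obtain ⟨θ, hθ, q, hq0, hq1, hq⟩ := exists_exp_moment hF hx hlam hload
  have hexp := lintegral_exp_pastWorkload_le hq0 hq1 hq
  have hq' : 0 < 1 - q := by linarith
  have hv : ∀ n, meanWorkload lam F x n ≤ ENNReal.ofReal (1 / θ * (1 / (1 - q))) := fun n => by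
    rw [ENNReal.ofReal_mul (by positivity)]
    have hm := measurable_pastWorkload_right x n
    refine le_trans ?_ (mul_le_mul_right (hexp n) _)
    rw [← lintegral_const_mul _ (by fun_prop)]
    refine lintegral_mono fun p => ?_
    rw [← ENNReal.ofReal_mul (by positivity)]
    refine ENNReal.ofReal_le_ofReal ?_
    have := Real.add_one_le_exp (θ * pastWorkload x n p)
    rw [one_div_mul_eq_div, le_div_iff₀ hθ]
    linarith
  have hs : ∀ n, sqWorkload lam F x n ≤ ENNReal.ofReal (2 / θ ^ 2 * (1 / (1 - q))) := fun n => by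
    rw [ENNReal.ofReal_mul (by positivity)]
    have hm := measurable_pastWorkload_right x n
    refine le_trans ?_ (mul_le_mul_right (hexp n) _)
    rw [← lintegral_const_mul _ (by fun_prop)]
    refine lintegral_mono fun p => ?_
    rw [← ENNReal.ofReal_mul (by positivity)]
    refine ENNReal.ofReal_le_ofReal ?_
    have hp := pastWorkload_nonneg x n p
    have := Real.quadratic_le_exp_of_nonneg (mul_nonneg hθ.le hp)
    rw [div_mul_eq_mul_div, le_div_iff₀ (by positivity)]
    nlinarith [mul_nonneg hθ.le hp]
  have hvt : ∀ n, meanWorkload lam F x n ≠ ∞ := fun n => ((hv n).trans_lt ENNReal.ofReal_lt_top).ne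
  have hst : ∀ n, sqWorkload lam F x n ≠ ∞ := fun n => ((hs n).trans_lt ENNReal.ofReal_lt_top).ne
  have hVt : ⨆ n, meanWorkload lam F x n ≠ ∞ :=
    ((iSup_le hv).trans_lt ENNReal.ofReal_lt_top).ne
  have hSt : ⨆ n, sqWorkload lam F x n ≠ ∞ :=
    ((iSup_le hs).trans_lt ENNReal.ofReal_lt_top).ne
  have hVlim := (ENNReal.tendsto_toReal hVt).comp
    (tendsto_atTop_iSup (meanWorkload_mono (lam := lam) (F := F) x))
  have hSlim := (ENNReal.tendsto_toReal hSt).comp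
    (tendsto_atTop_iSup (sqWorkload_mono (lam := lam) (F := F) x))
  have hm0 := truncMean_nonneg hF hx
  have hs0 := truncSq_nonneg F x
  have hrec : ∀ n, (sqWorkload lam F x (n + 1)).toReal +
      2 / lam * (meanWorkload lam F x (n + 1)).toReal = (sqWorkload lam F x n).toReal +
        2 * truncMean F x * (meanWorkload lam F x n).toReal + truncSq F x := fun n => by
    have := congrArg ENNReal.toReal (sqWorkload_succ hlam hF hx n)
    rw [ENNReal.toReal_add (hst _) (by finiteness [hvt (n + 1)]),
      ENNReal.toReal_add (by finiteness [hvt n, hst n]) (by finiteness),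
      ENNReal.toReal_add (hst _) (by finiteness [hvt n]), ENNReal.toReal_mul, ENNReal.toReal_mul,
      ENNReal.toReal_ofReal (by positivity), ENNReal.toReal_ofReal (by positivity),
      ENNReal.toReal_ofReal hs0] at this
    exact this
  have hlim1 := (hSlim.comp (tendsto_add_atTop_nat 1)).add
    ((hVlim.comp (tendsto_add_atTop_nat 1)).const_mul (2 / lam))
  have hlim2 := (hSlim.add (hVlim.const_mul (2 * truncMean F x))).add_const (truncSq F x)
  -- In the limit the second moments on both sides agree and, being finite, cancel, which leaves a
  -- linear equation for the mean.
  have heq := tendsto_nhds_unique hlim1 (hlim2.congr fun n => (hrec n).symm)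
  rw [← ENNReal.ofReal_toReal hVt]
  congr 1
  have h1 : 0 < 1 - lam * truncMean F x := by linarith
  rw [eq_div_iff (by positivity)]
  field_simp at heq
  linarith

end Workload

/-! ### Mean busy period and mean sojourn time -/

section BusyPeriod

/-- The time needed to clear the workload `w` and the requirements of at most `m` subsequent
customers, truncated at `x`, if the next customer arrives after time `a`. -/
noncomputable def busyStep (x : ℝ) (m : ℕ) (w a : ℝ) (z : ℕ → ℝ × ℝ) : ℝ :=
  if a < w then a + busy x m (w - a) z else w

lemma busy_cons (x : ℝ) (m : ℕ) (v b a : ℝ) (z : ℕ → ℝ × ℝ) :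
    busy x (m + 1) v (cons (b, a) z) = busyStep x m (v + min b x) a z := rfl

lemma measurable_busyStep (x : ℝ) (m : ℕ) :
    Measurable fun r : ℝ × ℝ × (ℕ → ℝ × ℝ) => busyStep x m r.1 r.2.1 r.2.2 := by
  have h : Measurable fun r : ℝ × ℝ × (ℕ → ℝ × ℝ) => busy x m (r.1 - r.2.1) r.2.2 :=
    (measurable_busy m).comp (by fun_prop : Measurable fun r : ℝ × ℝ × (ℕ → ℝ × ℝ) =>
      (x, r.1 - r.2.1, r.2.2))
  exact Measurable.ite (measurableSet_lt (by fun_prop) (by fun_prop)) (by fun_prop) (by fun_prop)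

lemma busyStep_le_succ {x : ℝ} (hx : 0 ≤ x) (m : ℕ) (w a : ℝ) {z : ℕ → ℝ × ℝ}
    (hz : ∀ k, 0 ≤ (z k).1) : busyStep x m w a z ≤ busyStep x (m + 1) w a z := by
  unfold busyStep
  split_ifs
  · linarith [busy_le_succ hx m hz (w - a)]
  · exact le_rfl

variable {lam : ℝ} {F : Measure ℝ} [IsProbabilityMeasure F] [IsProbabilityMeasure (expMeasure lam)]

/-- The mean time needed to clear the workload `v` and the requirements of `m` customers. -/
noncomputable def meanBusy (lam : ℝ) (F : Measure ℝ) [IsProbabilityMeasure F]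
    [IsProbabilityMeasure (expMeasure lam)] (x : ℝ) (m : ℕ) (v : ℝ) : ℝ≥0∞ :=
  ∫⁻ z, ENNReal.ofReal (busy x m v z) ∂(seqLaw (F.prod (expMeasure lam)))

/-- The mean time needed to clear the workload `w` and the requirements of `m` customers, the first
of which arrives after an exponential time. -/
noncomputable def meanStep (lam : ℝ) (F : Measure ℝ) [IsProbabilityMeasure F]
    [IsProbabilityMeasure (expMeasure lam)] (x : ℝ) (m : ℕ) (w : ℝ) : ℝ≥0∞ :=
  ∫⁻ a, ∫⁻ z, ENNReal.ofReal (busyStep x m w a z)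
    ∂(seqLaw (F.prod (expMeasure lam))) ∂(expMeasure lam)

lemma measurable_lintegral_busyStep (x : ℝ) (m : ℕ) :
    Measurable fun r : ℝ × ℝ => ∫⁻ z, ENNReal.ofReal (busyStep x m r.1 r.2 z)
      ∂(seqLaw (F.prod (expMeasure lam))) := by
  have h : Measurable fun r : (ℝ × ℝ) × (ℕ → ℝ × ℝ) => busyStep x m r.1.1 r.1.2 r.2 :=
    (measurable_busyStep x m).comp (by fun_prop : Measurable fun r : (ℝ × ℝ) × (ℕ → ℝ × ℝ) =>
      (r.1.1, r.1.2, r.2))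
  exact h.ennreal_ofReal.lintegral_prod_right'

lemma measurable_meanStep (x : ℝ) (m : ℕ) : Measurable (meanStep lam F x m) :=
  (measurable_lintegral_busyStep x m).lintegral_prod_right'

lemma meanBusy_succ (x : ℝ) (m : ℕ) (v : ℝ) :
    meanBusy lam F x (m + 1) v = ∫⁻ b, meanStep lam F x m (v + min b x) ∂F := by
  have h : Measurable fun z : ℕ → ℝ × ℝ => busy x (m + 1) v z :=
    (measurable_busy (m + 1)).comp (by fun_prop : Measurable fun z : ℕ → ℝ × ℝ => (x, v, z))
  have h2 : Measurable fun r : ℝ × ℝ => ∫⁻ z, ENNReal.ofReal (busyStep x m (v + min r.1 x) r.2 z)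
      ∂(seqLaw (F.prod (expMeasure lam))) :=
    (measurable_lintegral_busyStep x m).comp
      (by fun_prop : Measurable fun r : ℝ × ℝ => (v + min r.1 x, r.2))
  rw [meanBusy, lintegral_seqLaw _ h.ennreal_ofReal]
  exact lintegral_prod _ h2.aemeasurable

variable (hlam : 0 < lam) (hF : ∀ᵐ b ∂F, 0 < b) {x : ℝ} (hx : 0 < x)

include hF in
lemma ae_seqLaw_nonneg : ∀ᵐ z ∂(seqLaw (F.prod (expMeasure lam))), ∀ k, 0 ≤ (z k).1 :=
  ae_seqLaw _ (measurePreserving_fst.quasiMeasurePreserving.ae (hF.mono fun _ h => h.le))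

include hF hx in
lemma meanStep_eq (m : ℕ) (w : ℝ) :
    meanStep lam F x m w = ∫⁻ a, (if a < w then ENNReal.ofReal a + meanBusy lam F x m (w - a)
      else ENNReal.ofReal w) ∂(expMeasure lam) := by
  refine lintegral_congr_ae ?_
  filter_upwards [ae_pos_expMeasure lam] with a ha
  unfold busyStep
  split_ifs with haw
  · rw [lintegral_congr_ae (g := fun z => ENNReal.ofReal a + ENNReal.ofReal (busy x m (w - a) z)),
      lintegral_add_left measurable_const]
    · simp [meanBusy]
    · filter_upwards [ae_seqLaw_nonneg (lam := lam) hF] with z hz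
      rw [ENNReal.ofReal_add ha.le]
      linarith [le_busy hx.le m hz (w - a)]
  · simp

-- The affine bound `K v + (K - 1) / lam` is tailored to the first-step equation, which returns
-- exactly `K w`.
include hlam hF hx in
lemma meanStep_le {m : ℕ} {K w : ℝ} (hK : 1 ≤ K) (hw : 0 ≤ w)
    (h : ∀ v, 0 ≤ v → meanBusy lam F x m v ≤ ENNReal.ofReal (K * v + (K - 1) / lam)) :
    meanStep lam F x m w ≤ ENNReal.ofReal (K * w) := by
  rw [meanStep_eq hF hx, ← lintegral_expMeasure_busy hlam hw hK]
  refine lintegral_mono_ae ?_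
  filter_upwards [ae_pos_expMeasure lam] with a ha
  split_ifs with haw
  · have h1 : 0 ≤ K * (w - a) + (K - 1) / lam :=
      add_nonneg (mul_nonneg (by linarith) (by linarith)) (div_nonneg (by linarith) hlam.le)
    rw [add_assoc, ENNReal.ofReal_add ha.le h1]
    exact add_le_add_right (h _ (by linarith)) _
  · exact le_rfl

-- Lower counterpart: the deficit is carried through the gap as an exponential, to be contracted by
-- `exists_exp_moment`.
include hlam hF hx in
lemma le_meanStep_add {m : ℕ} {K w D θ : ℝ} (hK : 1 ≤ K) (hw : 0 ≤ w)
    (h : ∀ v, 0 ≤ v → ENNReal.ofReal (K * v + (K - 1) / lam) ≤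
      meanBusy lam F x m v + ENNReal.ofReal (D * Real.exp (θ * v))) :
    ENNReal.ofReal (K * w) ≤ meanStep lam F x m w +
      ∫⁻ a, ENNReal.ofReal (D * Real.exp (θ * (w - a))) ∂(expMeasure lam) := by
  rw [meanStep_eq hF hx, ← lintegral_expMeasure_busy hlam hw hK,
    ← lintegral_add_right _ (by fun_prop)]
  refine lintegral_mono_ae ?_
  filter_upwards [ae_pos_expMeasure lam] with a ha
  split_ifs with haw
  · have h1 : 0 ≤ K * (w - a) + (K - 1) / lam :=
      add_nonneg (mul_nonneg (by linarith) (by linarith)) (div_nonneg (by linarith) hlam.le)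
    rw [add_assoc, ENNReal.ofReal_add ha.le h1, add_assoc]
    exact add_le_add_right (h _ (by linarith)) _
  · exact le_self_add

include hF hx in
lemma lintegral_linear {K : ℝ} (hK : 0 ≤ K) {v : ℝ} (hv : 0 ≤ v) :
    ∫⁻ b, ENNReal.ofReal (K * (v + min b x)) ∂F = ENNReal.ofReal (K * v + K * truncMean F x) := by
  have hm := truncMean_nonneg hF hx
  have : ∀ᵐ b ∂F, ENNReal.ofReal (K * (v + min b x)) =
      ENNReal.ofReal (K * v) + ENNReal.ofReal K * ENNReal.ofReal (min b x) := by
    filter_upwards [hF] with b hb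
    have hc : 0 ≤ min b x := le_min hb.le hx.le
    rw [← ENNReal.ofReal_mul hK, ← ENNReal.ofReal_add (by positivity) (by positivity), mul_add]
  rw [lintegral_congr_ae this, lintegral_add_left measurable_const,
    lintegral_const_mul _ (by fun_prop), lintegral_min hF hx, ← ENNReal.ofReal_mul hK]
  simp only [lintegral_const, measure_univ, mul_one]
  rw [← ENNReal.ofReal_add (by positivity) (by positivity)]

include hlam hF hx in
/-- The mean length of a busy period that starts with the workload `w`. -/
theorem iSup_meanStep (hload : lam * truncMean F x < 1) {w : ℝ} (hw : 0 ≤ w) :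
    ⨆ m, meanStep lam F x m w = ENNReal.ofReal (1 / (1 - lam * truncMean F x) * w) := by
  have hm0 := truncMean_nonneg hF hx
  have hden : 0 < 1 - lam * truncMean F x := by linarith
  set K := 1 / (1 - lam * truncMean F x) with hKdef
  have hK : 1 ≤ K := by
    rw [hKdef, le_div_iff₀ hden]
    nlinarith [mul_nonneg hlam.le hm0]
  have hK0 : 0 ≤ K := by linarith
  -- This identity fixes `K`: a customer arriving at once adds `K` times its mean truncated
  -- requirement, and that must be the constant of the affine bound.
  have hKm : K * truncMean F x = (K - 1) / lam := by
    rw [hKdef]; field_simp; ring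
  have hupper : ∀ m v, 0 ≤ v → meanBusy lam F x m v ≤ ENNReal.ofReal (K * v + (K - 1) / lam) := by
    intro m
    induction m with
    | zero =>
      intro v hv
      simp only [meanBusy, busy, lintegral_const, measure_univ, mul_one]
      refine ENNReal.ofReal_le_ofReal ?_
      have : 0 ≤ (K - 1) / lam := div_nonneg (by linarith) hlam.le
      nlinarith
    | succ m ih =>
      intro v hv
      rw [meanBusy_succ, ← hKm, ← lintegral_linear hF hx hK0 hv]
      refine lintegral_mono_ae ?_
      filter_upwards [hF] with b hb
      exact meanStep_le hlam hF hx hK (add_nonneg hv (le_min hb.le hx.le)) ih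
  obtain ⟨θ, hθ, q, hq0, hq1, hq⟩ := exists_exp_moment hF hx hlam hload
  -- `C` is large enough for `C exp (θ v)` alone to dominate the affine function, so the lower bound
  -- holds at stage 0; each further customer multiplies the error by `q`.
  set C := K * (1 / θ + truncMean F x) with hC
  have hC0 : 0 ≤ C := by positivity
  have hlower : ∀ m v, 0 ≤ v → ENNReal.ofReal (K * v + (K - 1) / lam) ≤
      meanBusy lam F x m v + ENNReal.ofReal (C * q ^ m * Real.exp (θ * v)) := by
    intro m
    induction m with
    | zero =>
      intro v hv
      refine le_trans (ENNReal.ofReal_le_ofReal ?_) le_add_self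
      have h1 := Real.add_one_le_exp (θ * v)
      have h2 : 1 ≤ Real.exp (θ * v) := Real.one_le_exp (by positivity)
      have h3 : v ≤ 1 / θ * Real.exp (θ * v) := by
        rw [one_div_mul_eq_div, le_div_iff₀ hθ]; linarith
      have h4 : truncMean F x ≤ truncMean F x * Real.exp (θ * v) := le_mul_of_one_le_right hm0 h2
      rw [← hKm, hC, pow_zero, mul_one]
      calc K * v + K * truncMean F x = K * (v + truncMean F x) := by ring
        _ ≤ K * (1 / θ * Real.exp (θ * v) + truncMean F x * Real.exp (θ * v)) := by gcongr
        _ = _ := by ring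
    | succ m ih =>
      intro v hv
      rw [meanBusy_succ, ← hKm, ← lintegral_linear hF hx hK0 hv]
      have hD : 0 ≤ C * q ^ m := by positivity
      calc _ ≤ ∫⁻ b, (meanStep lam F x m (v + min b x) + ∫⁻ a, ENNReal.ofReal
            (C * q ^ m * Real.exp (θ * (v + min b x - a))) ∂(expMeasure lam)) ∂F := by
            refine lintegral_mono_ae ?_
            filter_upwards [hF] with b hb
            exact le_meanStep_add hlam hF hx hK (add_nonneg hv (le_min hb.le hx.le)) ih
        _ = ∫⁻ b, meanStep lam F x m (v + min b x) ∂F + ∫⁻ b, ∫⁻ a, ENNReal.ofReal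
            (C * q ^ m * Real.exp (θ * (v + min b x - a))) ∂(expMeasure lam) ∂F :=
            lintegral_add_left ((measurable_meanStep x m).comp (by fun_prop)) _
        _ ≤ _ := by
            refine add_le_add_right ?_ _
            simp_rw [ENNReal.ofReal_mul hD]
            simp_rw [fun b => lintegral_const_mul (μ := expMeasure lam) (ENNReal.ofReal (C * q ^ m))
              (f := fun a => ENNReal.ofReal (Real.exp (θ * (v + min b x - a)))) (by fun_prop)]
            rw [lintegral_const_mul _ (by fun_prop)]
            refine (mul_le_mul_right (hq v) _).trans ?_
            rw [← ENNReal.ofReal_mul hD]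
            refine ENNReal.ofReal_le_ofReal (le_of_eq ?_)
            ring
  refine le_antisymm (iSup_le fun m => meanStep_le hlam hF hx hK hw (hupper m)) ?_
  have hbound : ∀ m, ENNReal.ofReal (K * w) ≤ (⨆ m, meanStep lam F x m w) +
      ENNReal.ofReal (C * q ^ m * Real.exp (θ * w)) := by
    intro m
    have hD : 0 ≤ C * q ^ m := by positivity
    refine (le_meanStep_add hlam hF hx hK hw (hlower m)).trans
      (add_le_add (le_iSup (fun m => meanStep lam F x m w) m) ?_)
    calc _ ≤ ∫⁻ _, ENNReal.ofReal (C * q ^ m * Real.exp (θ * w)) ∂(expMeasure lam) := by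
          refine lintegral_mono_ae ?_
          filter_upwards [ae_pos_expMeasure lam] with a ha
          refine ENNReal.ofReal_le_ofReal (mul_le_mul_of_nonneg_left (Real.exp_le_exp.2 ?_) hD)
          exact mul_le_mul_of_nonneg_left (by linarith) hθ.le
      _ = _ := by simp
  refine ge_of_tendsto' (x := atTop) ?_ hbound
  have h1 : Tendsto (fun m => C * q ^ m * Real.exp (θ * w)) atTop (𝓝 0) := by
    simpa using ((tendsto_pow_atTop_nhds_zero_of_lt_one hq0 hq1).const_mul C).mul_const
      (Real.exp (θ * w))
  simpa using (ENNReal.tendsto_ofReal h1).const_add (⨆ m, meanStep lam F x m w)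

lemma pastSojourn_cons {b : ℝ} (n : ℕ) (p z : ℕ → ℝ × ℝ) (a : ℝ) :
    pastSojourn n (p, cons (b, a) z) =
      ⨆ m, ENNReal.ofReal (busyStep b m (pastWorkload b n p + b) a z) := by
  simp only [pastSojourn, cons_zero, busy_cons, min_self]

include hlam hF in
lemma lintegral_pastSojourn_cons {b : ℝ} (hb : 0 < b) (hload : lam * truncMean F b < 1) (n : ℕ)
    (p : ℕ → ℝ × ℝ) :
    ∫⁻ a, ∫⁻ z, pastSojourn n (p, cons (b, a) z) ∂(seqLaw (F.prod (expMeasure lam)))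
      ∂(expMeasure lam) =
      ENNReal.ofReal (1 / (1 - lam * truncMean F b) * (pastWorkload b n p + b)) := by
  have hw : 0 ≤ pastWorkload b n p + b := add_nonneg (pastWorkload_nonneg _ _ _) hb.le
  rw [← iSup_meanStep hlam hF hb hload hw]
  set w := pastWorkload b n p + b
  have hmono : ∀ a, ∀ m, ∀ᵐ z ∂(seqLaw (F.prod (expMeasure lam))),
      ENNReal.ofReal (busyStep b m w a z) ≤ ENNReal.ofReal (busyStep b (m + 1) w a z) := by
    intro a m
    filter_upwards [ae_seqLaw_nonneg (lam := lam) hF] with z hz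
    exact ENNReal.ofReal_le_ofReal (busyStep_le_succ hb.le m w a hz)
  have hmeas : ∀ a m, Measurable fun z : ℕ → ℝ × ℝ => ENNReal.ofReal (busyStep b m w a z) :=
    fun a m => ((measurable_busyStep b m).comp (by fun_prop :
      Measurable fun z : ℕ → ℝ × ℝ => (w, a, z))).ennreal_ofReal
  have hmeas2 : ∀ m, Measurable fun a : ℝ => ∫⁻ z, ENNReal.ofReal (busyStep b m w a z)
      ∂(seqLaw (F.prod (expMeasure lam))) :=
    fun m => (measurable_lintegral_busyStep b m).comp (by fun_prop : Measurable fun a : ℝ => (w, a))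
  have h1 : ∀ a, ∫⁻ z, pastSojourn n (p, cons (b, a) z) ∂(seqLaw (F.prod (expMeasure lam))) =
      ⨆ m, ∫⁻ z, ENNReal.ofReal (busyStep b m w a z) ∂(seqLaw (F.prod (expMeasure lam))) := by
    intro a
    rw [← lintegral_iSup_ae (hmeas a) (hmono a)]
    exact lintegral_congr fun z => pastSojourn_cons n p z a
  rw [lintegral_congr h1]
  exact lintegral_iSup hmeas2 (monotone_nat_of_le_succ fun m a => lintegral_mono_ae (hmono a m))

-- The truncation level is the tagged job's own size `b`, and the past is independent of it. So the
-- mean busy period factor multiplies the mean workload found plus `b`, after monotone convergence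
-- in the number of predecessors.
include hlam hF in
lemma lintegral_limitSojourn_cons {b : ℝ} (hb : 0 < b) (hload : lam * truncMean F b < 1) :
    ∫⁻ p, ∫⁻ a, ∫⁻ z, limitSojourn (p, cons (b, a) z) ∂(seqLaw (F.prod (expMeasure lam)))
      ∂(expMeasure lam) ∂(seqLaw (F.prod (expMeasure lam))) =
      ENNReal.ofReal ((b + lam * truncSq F b / (2 * (1 - lam * truncMean F b))) /
        (1 - lam * truncMean F b)) := by
  set Q := seqLaw (F.prod (expMeasure lam)) with hQ
  have hden : 0 < 1 - lam * truncMean F b := by linarith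
  have hs0 := truncSq_nonneg F b
  have hmeas3 : ∀ n, Measurable fun r : ((ℕ → ℝ × ℝ) × ℝ) × (ℕ → ℝ × ℝ) =>
      pastSojourn n (r.1.1, cons (b, r.1.2) r.2) := fun n =>
    (measurable_pastSojourn n).comp (by fun_prop :
      Measurable fun r : ((ℕ → ℝ × ℝ) × ℝ) × (ℕ → ℝ × ℝ) => (r.1.1, cons (b, r.1.2) r.2))
  have hmeas2 : ∀ n, Measurable fun r : (ℕ → ℝ × ℝ) × ℝ =>
      ∫⁻ z, pastSojourn n (r.1, cons (b, r.2) z) ∂Q := fun n => (hmeas3 n).lintegral_prod_right'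
  have hmeas1 : ∀ n, Measurable fun p : ℕ → ℝ × ℝ =>
      ∫⁻ a, ∫⁻ z, pastSojourn n (p, cons (b, a) z) ∂Q ∂(expMeasure lam) :=
    fun n => (hmeas2 n).lintegral_prod_right'
  have hmono : ∀ p a n, ∀ᵐ z ∂Q, pastSojourn n (p, cons (b, a) z) ≤
      pastSojourn (n + 1) (p, cons (b, a) z) := by
    intro p a n
    filter_upwards [ae_seqLaw_nonneg (lam := lam) hF] with z hz
    have hz' : ∀ k, 0 ≤ (cons (b, a) z k).1 := fun k => by
      cases k with
      | zero => exact hb.le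
      | succ k => exact hz k
    exact pastSojourn_le_succ n (q := (p, cons (b, a) z)) hz'
  have hmono2 : ∀ p, Monotone fun n a => ∫⁻ z, pastSojourn n (p, cons (b, a) z) ∂Q :=
    fun p => monotone_nat_of_le_succ fun n a => lintegral_mono_ae (hmono p a n)
  have hmono1 : Monotone fun n p =>
      ∫⁻ a, ∫⁻ z, pastSojourn n (p, cons (b, a) z) ∂Q ∂(expMeasure lam) :=
    fun n n' hnn p => lintegral_mono (hmono2 p hnn)
  have hmz : ∀ p a n, Measurable fun z : ℕ → ℝ × ℝ => pastSojourn n (p, cons (b, a) z) :=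
    fun p a n => (measurable_pastSojourn n).comp
      (by fun_prop : Measurable fun z : ℕ → ℝ × ℝ => (p, cons (b, a) z))
  have hma : ∀ p n, Measurable fun a => ∫⁻ z, pastSojourn n (p, cons (b, a) z) ∂Q := by
    intro p n
    have h : Measurable fun r : ℝ × (ℕ → ℝ × ℝ) => pastSojourn n (p, cons (b, r.1) r.2) :=
      (measurable_pastSojourn n).comp
        (by fun_prop : Measurable fun r : ℝ × (ℕ → ℝ × ℝ) => (p, cons (b, r.1) r.2))
    exact h.lintegral_prod_right'
  have h1 : ∀ p a, ∫⁻ z, limitSojourn (p, cons (b, a) z) ∂Q =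
      ⨆ n, ∫⁻ z, pastSojourn n (p, cons (b, a) z) ∂Q := fun p a =>
    lintegral_iSup_ae (hmz p a) (hmono p a)
  have h1' : ∀ p, ∫⁻ a, ∫⁻ z, limitSojourn (p, cons (b, a) z) ∂Q ∂(expMeasure lam) =
      ⨆ n, ∫⁻ a, ∫⁻ z, pastSojourn n (p, cons (b, a) z) ∂Q ∂(expMeasure lam) := fun p => by
    rw [lintegral_congr (h1 p), lintegral_iSup (hma p) (hmono2 p)]
  rw [lintegral_congr h1']
  rw [lintegral_iSup hmeas1 hmono1]
  rw [iSup_congr fun n => lintegral_congr fun p => lintegral_pastSojourn_cons hlam hF hb hload n p]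
  set K := 1 / (1 - lam * truncMean F b) with hK
  have hK0 : 0 ≤ K := by positivity
  have h2 : ∀ n, ∫⁻ p, ENNReal.ofReal (K * (pastWorkload b n p + b)) ∂Q =
      ENNReal.ofReal K * (meanWorkload lam F b n + ENNReal.ofReal b) := by
    intro n
    have hm := measurable_pastWorkload_right b n
    simp_rw [ENNReal.ofReal_mul hK0, fun p => ENNReal.ofReal_add (pastWorkload_nonneg b n p) hb.le]
    rw [lintegral_const_mul _ (by fun_prop), lintegral_add_right _ (by fun_prop)]
    simp [meanWorkload, hQ]
  rw [iSup_congr h2, ← ENNReal.mul_iSup, ← ENNReal.iSup_add, iSup_meanWorkload hlam hF hb hload,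
    ← ENNReal.ofReal_add (by positivity) hb.le, ← ENNReal.ofReal_mul hK0]
  congr 1
  rw [hK]; ring

include hlam hF in
/-- The mean of the steady-state sojourn time under the Foreground-Background policy. -/
theorem lintegral_limitLaw (hload : ∀ b > 0, lam * truncMean F b < 1) :
    ∫⁻ t, t ∂(limitLaw (F.prod (expMeasure lam)) : Measure ℝ≥0∞) =
      ∫⁻ b, ENNReal.ofReal ((b + lam * truncSq F b / (2 * (1 - lam * truncMean F b))) /
        (1 - lam * truncMean F b)) ∂F := by
  set Q := seqLaw (F.prod (expMeasure lam)) with hQ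
  have hm := measurable_limitSojourn
  rw [coe_limitLaw, lintegral_map (f := fun t => t) measurable_id measurable_limitSojourn,
    lintegral_prod _ hm.aemeasurable]
  have h1 : ∀ p, ∫⁻ z, limitSojourn (p, z) ∂Q =
      ∫⁻ b, ∫⁻ a, ∫⁻ z, limitSojourn (p, cons (b, a) z) ∂Q ∂(expMeasure lam) ∂F := by
    intro p
    rw [lintegral_seqLaw _ (f := fun z => limitSojourn (p, z)) (hm.comp (by fun_prop))]
    refine lintegral_prod (fun y => ∫⁻ z, limitSojourn (p, cons y z) ∂Q)
      (Measurable.aemeasurable ?_)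
    have h2 : Measurable fun r : (ℝ × ℝ) × (ℕ → ℝ × ℝ) => limitSojourn (p, cons r.1 r.2) :=
      hm.comp (by fun_prop)
    exact h2.lintegral_prod_right'
  rw [lintegral_congr h1, lintegral_lintegral_swap]
  · refine lintegral_congr_ae ?_
    filter_upwards [hF] with b hb
    exact lintegral_limitSojourn_cons hlam hF hb (hload b hb)
  · have h3 : Measurable fun r : (((ℕ → ℝ × ℝ) × ℝ) × ℝ) × (ℕ → ℝ × ℝ) =>
        limitSojourn (r.1.1.1, cons (r.1.1.2, r.1.2) r.2) :=
      hm.comp (by fun_prop)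
    have h4 : Measurable fun r : ((ℕ → ℝ × ℝ) × ℝ) × ℝ =>
        ∫⁻ z, limitSojourn (r.1.1, cons (r.1.2, r.2) z) ∂Q := h3.lintegral_prod_right'
    have h5 : Measurable fun r : (ℕ → ℝ × ℝ) × ℝ =>
        ∫⁻ a, ∫⁻ z, limitSojourn (r.1, cons (r.2, a) z) ∂Q ∂(expMeasure lam) :=
      h4.lintegral_prod_right'
    exact h5.aemeasurable

end BusyPeriod

/-! ### The Pareto law in the variable v -/

section Pareto

/-- The law on `(0, 1)` with density `(1 + p) u ^ p`. -/
noncomputable def powerLaw (p : ℝ) : Measure ℝ :=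
  (volume.restrict (Set.Ioo 0 1)).withDensity fun u => ENNReal.ofReal ((1 + p) * u ^ p)

variable {p : ℝ} (hp : 0 < p)
include hp

lemma setLIntegral_rpow {z : ℝ} (hz : 0 ≤ z) :
    ∫⁻ u in Set.Ioo 0 z, ENNReal.ofReal ((1 + p) * u ^ p) = ENNReal.ofReal (z ^ (1 + p)) := by
  have hcont : Continuous fun u : ℝ => (1 + p) * u ^ p :=
    continuous_const.mul (Real.continuous_rpow_const hp.le)
  rw [← ofReal_integral_eq_lintegral_ofReal
    ((hcont.integrableOn_Icc (a := 0) (b := z)).mono_set Set.Ioo_subset_Icc_self)]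
  · rw [← integral_Ioc_eq_integral_Ioo, ← intervalIntegral.integral_of_le hz,
      intervalIntegral.integral_const_mul, integral_rpow (Or.inl (by linarith)),
      Real.zero_rpow (by positivity), add_comm p 1]
    congr 1
    field_simp
    ring
  · refine (ae_restrict_iff' measurableSet_Ioo).2 (Eventually.of_forall fun u hu => ?_)
    have := hu.1
    show 0 ≤ (1 + p) * u ^ p
    positivity

lemma isProbabilityMeasure_powerLaw : IsProbabilityMeasure (powerLaw p) := by
  constructor
  rw [powerLaw, withDensity_apply _ MeasurableSet.univ, Measure.restrict_univ,
    setLIntegral_rpow hp zero_le_one]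
  simp

variable {xL : ℝ} (hxL : 0 < xL) {F : Measure ℝ} [IsProbabilityMeasure F]
  (hF : ∀ x : ℝ, xL ≤ x → F.real (Set.Ioi x) = (x / xL) ^ (-((1 + p) / p)))

-- For `a ≥ xL`, `xL u^(-p) > a` means `u < (a / xL)^(-1/p)`, an event of probability `(a / xL)^(-(1
-- + p)/p)` under `powerLaw p`.
include hxL hF in
lemma pareto_eq_map : F = (powerLaw p).map fun u => xL * u ^ (-p) := by
  have hm : Measurable fun u : ℝ => xL * u ^ (-p) := by fun_prop
  have := isProbabilityMeasure_powerLaw hp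
  have := Measure.isProbabilityMeasure_map (μ := powerLaw p) hm.aemeasurable
  have hIoi : ∀ a, F (Set.Ioi a) = ((powerLaw p).map fun u => xL * u ^ (-p)) (Set.Ioi a) := by
    intro a
    rw [Measure.map_apply hm measurableSet_Ioi, powerLaw,
      withDensity_apply _ (hm measurableSet_Ioi), Measure.restrict_restrict (hm measurableSet_Ioi)]
    rcases lt_or_ge a xL with ha | ha
    · have hset : (fun u : ℝ => xL * u ^ (-p)) ⁻¹' Set.Ioi a ∩ Set.Ioo 0 1 = Set.Ioo 0 1 := by
        refine Set.inter_eq_right.2 fun u hu => ?_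
        have h1 : 1 ≤ u ^ (-p) :=
          Real.one_le_rpow_of_pos_of_le_one_of_nonpos hu.1 hu.2.le (by linarith)
        show a < xL * u ^ (-p)
        nlinarith
      rw [hset, setLIntegral_rpow hp zero_le_one, Real.one_rpow, ENNReal.ofReal_one]
      -- The tail formula at `xL` equals 1, so `F` puts no mass on `(-∞, xL]`.
      have h1 := hF xL le_rfl
      rw [div_self hxL.ne', Real.one_rpow, Measure.real, ENNReal.toReal_eq_one_iff] at h1
      exact le_antisymm prob_le_one (h1 ▸ measure_mono (Set.Ioi_subset_Ioi ha.le))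
    · set y := a / xL with hy
      have hy1 : 1 ≤ y := (one_le_div hxL).2 ha
      have hy0 : 0 < y := by linarith
      have hset : (fun u : ℝ => xL * u ^ (-p)) ⁻¹' Set.Ioi a ∩ Set.Ioo 0 1 =
          Set.Ioo 0 (y ^ (-(1 / p))) := by
        ext u
        simp only [Set.mem_inter_iff, Set.mem_preimage, Set.mem_Ioi, Set.mem_Ioo]
        have hz1 : y ^ (-(1 / p)) ≤ 1 := Real.rpow_le_one_of_one_le_of_nonpos hy1 (by simp [hp.le])
        have key : ∀ u : ℝ, 0 < u → (a < xL * u ^ (-p) ↔ u < y ^ (-(1 / p))) := by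
          intro u hu
          rw [mul_comm, ← div_lt_iff₀ hxL, ← hy]
          rw [Real.lt_rpow_iff_log_lt hy0 hu, Real.lt_rpow_iff_log_lt hu hy0,
            show -(1 / p) * Real.log y = -Real.log y / p by ring, lt_div_iff₀ hp]
          constructor <;> intro h <;> linarith
        constructor
        · rintro ⟨h1, h2, h3⟩
          exact ⟨h2, (key u h2).1 h1⟩
        · rintro ⟨h1, h2⟩
          exact ⟨(key u h1).2 h2, h1, h2.trans_le hz1⟩
      rw [hset, setLIntegral_rpow hp (by positivity), ← Real.rpow_mul hy0.le,
        ← ENNReal.ofReal_toReal (measure_ne_top F (Set.Ioi a)), ← Measure.real, hF a ha]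
      congr 2
      field_simp
  refine Measure.ext_of_Iic _ _ fun a => ?_
  rw [← Set.compl_Ioi, prob_compl_eq_one_sub measurableSet_Ioi,
    prob_compl_eq_one_sub measurableSet_Ioi, hIoi]

include hxL hF in
lemma integral_pareto {f : ℝ → ℝ} (hf : Measurable f) :
    ∫ x, f x ∂F = ∫ u in (0 : ℝ)..1, (1 + p) * u ^ p * f (xL * u ^ (-p)) := by
  rw [pareto_eq_map hp hxL hF, integral_map (by fun_prop) hf.aestronglyMeasurable, powerLaw,
    integral_withDensity_eq_integral_toReal_smul (by fun_prop)
      (Eventually.of_forall fun _ => ENNReal.ofReal_lt_top),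
    intervalIntegral.integral_of_le zero_le_one, integral_Ioc_eq_integral_Ioo]
  refine setIntegral_congr_fun measurableSet_Ioo fun u hu => ?_
  have := hu.1
  simp only [smul_eq_mul]
  rw [ENNReal.toReal_ofReal (by positivity)]

include hxL hF in
include hxL hF in
lemma ae_pareto_pos : ∀ᵐ x ∂F, 0 < x := by
  rw [pareto_eq_map hp hxL hF]
  refine (ae_map_iff (by fun_prop) measurableSet_Ioi).2 ?_
  refine (withDensity_absolutelyContinuous _ _).ae_le ?_
  filter_upwards [ae_restrict_mem measurableSet_Ioo] with u hu
  exact mul_pos hxL (Real.rpow_pos_of_pos hu.1 _)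

include hxL hF in
lemma integral_pareto_id : ∫ x, x ∂F = (1 + p) * xL := by
  rw [integral_pareto hp hxL hF (f := fun x => x) measurable_id, intervalIntegral.integral_congr_Ioo_of_le zero_le_one
    (g := fun _ => (1 + p) * xL)]
  · simp
  · intro u hu
    have := hu.1
    simp only
    rw [Real.rpow_neg hu.1.le]
    field_simp

include hxL hF in
lemma integrable_pareto_id : Integrable (fun x => x) F := by
  -- A non-integrable function would have the default integral 0, contradicting the positive value
  -- just computed.
  by_contra h
  have h1 := integral_undef h
  rw [integral_pareto_id hp hxL hF] at h1
  have : 0 < (1 + p) * xL := by positivity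
  linarith

include hxL hF in
lemma integral_pareto_sq (hp1 : p < 1) : ∫ x, x ^ 2 ∂F = (1 + p) / (1 - p) * xL ^ 2 := by
  rw [integral_pareto hp hxL hF (f := fun x => x ^ 2) (by fun_prop),
    intervalIntegral.integral_congr_Ioo_of_le zero_le_one
    (g := fun u => (1 + p) * xL ^ 2 * u ^ (-p))]
  · rw [intervalIntegral.integral_const_mul, integral_rpow (Or.inl (by linarith)),
      Real.zero_rpow (by linarith), Real.one_rpow]
    have : 1 - p ≠ 0 := by linarith
    rw [show -p + 1 = 1 - p by ring]
    field_simp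
    ring
  · intro u hu
    have h0 := hu.1
    have : u ^ p ≠ 0 := by positivity
    simp only
    rw [Real.rpow_neg hu.1.le]
    field_simp

-- The truncation at `xL v^(-p)` is active exactly for `u < v`, so the integral splits at `v`.
include hxL hF in
lemma integral_min_pow_pareto (k : ℕ) {v : ℝ} (hv : v ∈ Set.Ioo (0 : ℝ) 1) :
    ∫ b, min b (xL * v ^ (-p)) ^ k ∂F =
      xL ^ k * (v ^ (1 + p - k * p) + (1 + p) * ∫ u in v..1, u ^ (p - k * p)) := by
  have hv0 := hv.1
  rw [integral_pareto hp hxL hF (f := fun b => min b (xL * v ^ (-p)) ^ k) (by fun_prop)]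
  have hpow : ∀ u : ℝ, 0 < u → (u ^ (-p)) ^ k = u ^ (-(k * p)) := fun u hu => by
    rw [← Real.rpow_natCast, ← Real.rpow_mul hu.le]
    congr 1; ring
  have e1 : Set.EqOn (fun u => xL ^ k * v ^ (-(k * p)) * ((1 + p) * u ^ p))
      (fun u => (1 + p) * u ^ p * min (xL * u ^ (-p)) (xL * v ^ (-p)) ^ k)
      (Set.uIoo 0 v) := by
    intro u hu
    rw [Set.uIoo_of_le hv0.le] at hu
    have h1 : v ^ (-p) ≤ u ^ (-p) :=
      Real.rpow_le_rpow_of_nonpos hu.1 hu.2.le (by linarith)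
    simp only
    rw [min_eq_right (by gcongr), mul_pow, hpow v hv0]
    ring
  have e2 : Set.EqOn (fun u => xL ^ k * (1 + p) * u ^ (p - k * p))
      (fun u => (1 + p) * u ^ p * min (xL * u ^ (-p)) (xL * v ^ (-p)) ^ k)
      (Set.uIoo v 1) := by
    intro u hu
    rw [Set.uIoo_of_le hv.2.le] at hu
    have hu0 : 0 < u := hv0.trans hu.1
    have h1 : u ^ (-p) ≤ v ^ (-p) :=
      Real.rpow_le_rpow_of_nonpos hv0 hu.1.le (by linarith)
    simp only
    rw [min_eq_left (by gcongr), mul_pow, hpow u hu0, sub_eq_add_neg, Real.rpow_add hu0]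
    ring
  have hcont : Continuous fun u : ℝ => xL ^ k * v ^ (-(k * p)) * ((1 + p) * u ^ p) :=
    continuous_const.mul (continuous_const.mul (Real.continuous_rpow_const hp.le))
  have i1 := (hcont.intervalIntegrable (μ := volume) 0 v).congr_uIoo e1
  have hnot : (0 : ℝ) ∉ Set.uIcc v 1 := by
    rw [Set.uIcc_of_le hv.2.le]
    exact fun h => absurd h.1 (not_le.2 hv0)
  have i2 : IntervalIntegrable (fun u => xL ^ k * (1 + p) * u ^ (p - k * p)) volume v 1 :=
    (intervalIntegral.intervalIntegrable_rpow (Or.inr hnot)).const_mul _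
  have e3 : v ^ (1 + p - k * p) = v ^ (-(k * p)) * v ^ (p + 1) := by
    rw [← Real.rpow_add hv0]
    congr 1; ring
  rw [← intervalIntegral.integral_add_adjacent_intervals i1 (i2.congr_uIoo e2),
    ← intervalIntegral.integral_congr_uIoo e1, ← intervalIntegral.integral_congr_uIoo e2,
    intervalIntegral.integral_const_mul, intervalIntegral.integral_const_mul,
    intervalIntegral.integral_const_mul, integral_rpow (Or.inl (by linarith)),
    Real.zero_rpow (by positivity), e3]
  field_simp
  ring

-- Linearity in `v` is the reason for the parameter `p`: it makes `1 - λ m` affine in the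
-- integration variable.
include hxL hF in
lemma truncMean_pareto {v : ℝ} (hv : v ∈ Set.Ioo (0 : ℝ) 1) :
    truncMean F (xL * v ^ (-p)) = xL * (1 + p - p * v) := by
  have h := integral_min_pow_pareto hp hxL hF 1 hv
  simp only [pow_one, Nat.cast_one, one_mul, sub_self, Real.rpow_zero, add_sub_cancel_right,
    Real.rpow_one, intervalIntegral.integral_const, smul_eq_mul, mul_one] at h
  rw [truncMean, h]
  ring

include hxL hF in
lemma truncSq_pareto (hp1 : p ≠ 1) {v : ℝ} (hv : v ∈ Set.Ioo (0 : ℝ) 1) :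
    truncSq F (xL * v ^ (-p)) = xL ^ 2 * ((1 + p - 2 * p * v ^ (1 - p)) / (1 - p)) := by
  have h := integral_min_pow_pareto hp hxL hF 2 hv
  have hnot : (0 : ℝ) ∉ Set.uIcc v 1 := by
    rw [Set.uIcc_of_le hv.2.le]
    exact fun h => absurd h.1 (not_le.2 hv.1)
  have h1 : 1 - p ≠ 0 := sub_ne_zero.2 hp1.symm
  rw [integral_rpow (Or.inr ⟨by push_cast; intro h; apply hp1; linarith, hnot⟩),
    Real.one_rpow] at h
  rw [truncSq, h]
  push_cast
  rw [show 1 + p - 2 * p = 1 - p by ring, show p - 2 * p + 1 = 1 - p by ring]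
  field_simp
  ring

end Pareto

/-! ### The Beta integral of s^p / (1 + s)² -/

section BetaIntegral

lemma lintegral_rpow_mul_exp_neg {a r : ℝ} (ha : 0 < a) (hr : 0 < r) :
    ∫⁻ t in Set.Ioi 0, ENNReal.ofReal (t ^ (a - 1) * Real.exp (-(r * t))) =
      ENNReal.ofReal ((1 / r) ^ a * Real.Gamma a) := by
  have h := Real.integral_rpow_mul_exp_neg_mul_Ioi ha hr
  rw [← h, ofReal_integral_eq_lintegral_ofReal]
  · by_contra hcon
    rw [integral_undef hcon] at h
    have : 0 < (1 / r) ^ a * Real.Gamma a :=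
      mul_pos (by positivity) (Real.Gamma_pos_of_pos ha)
    linarith
  · refine (ae_restrict_iff' measurableSet_Ioi).2 (Eventually.of_forall fun t ht => ?_)
    have : 0 < t := ht
    show 0 ≤ t ^ (a - 1) * Real.exp (-(r * t))
    positivity

/-- Write `1 / (1 + s)²` as the integral of `t exp (-(1 + s) t)` and exchange the order. This gives
`Γ(p + 1) Γ(1 - p)`, which the reflection formula evaluates. -/
lemma lintegral_rpow_div_one_add_sq {p : ℝ} (hp : 0 < p) (hp1 : p < 1) :
    ∫⁻ s in Set.Ioi 0, ENNReal.ofReal (s ^ p / (1 + s) ^ 2) =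
      ENNReal.ofReal (p * Real.pi / Real.sin (Real.pi * p)) := by
  have h1 : ∀ s ∈ Set.Ioi (0 : ℝ), ENNReal.ofReal (s ^ p / (1 + s) ^ 2) =
      ∫⁻ t in Set.Ioi 0, ENNReal.ofReal (s ^ p * (t * Real.exp (-((1 + s) * t)))) := by
    intro s hs
    have hs0 : 0 < s := hs
    have h := lintegral_rpow_mul_exp_neg (a := 2) (r := 1 + s) two_pos (by linarith)
    rw [Real.Gamma_two, mul_one] at h
    simp_rw [ENNReal.ofReal_mul (Real.rpow_nonneg hs0.le p)]
    rw [lintegral_const_mul _ (by fun_prop), div_eq_mul_inv,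
      ENNReal.ofReal_mul (Real.rpow_nonneg hs0.le p)]
    congr 1
    rw [show ((1 + s) ^ 2)⁻¹ = (1 / (1 + s)) ^ (2 : ℝ) by
      rw [one_div, ← Real.rpow_natCast, ← Real.inv_rpow (by positivity)]; norm_num, ← h]
    refine lintegral_congr fun t => ?_
    norm_num
  have h2 : ∀ t ∈ Set.Ioi (0 : ℝ),
      ∫⁻ s in Set.Ioi 0, ENNReal.ofReal (s ^ p * (t * Real.exp (-((1 + s) * t)))) =
        ENNReal.ofReal (Real.Gamma (p + 1)) *
          ENNReal.ofReal (t ^ ((1 - p) - 1) * Real.exp (-(1 * t))) := by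
    intro t ht
    have ht0 : 0 < t := ht
    have h := lintegral_rpow_mul_exp_neg (a := p + 1) (r := t) (by linarith) ht0
    rw [add_sub_cancel_right] at h
    have hG := Real.Gamma_pos_of_pos (show 0 < p + 1 by linarith)
    calc _ = ∫⁻ s in Set.Ioi 0, ENNReal.ofReal (t * Real.exp (-t)) *
          ENNReal.ofReal (s ^ p * Real.exp (-(t * s))) := by
          refine lintegral_congr fun s => ?_
          rw [← ENNReal.ofReal_mul (by positivity), show -((1 + s) * t) = -t + -(t * s) by ring,
            Real.exp_add]
          congr 1; ring
      _ = ENNReal.ofReal (t * Real.exp (-t)) *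
          ENNReal.ofReal ((1 / t) ^ (p + 1) * Real.Gamma (p + 1)) := by
          rw [lintegral_const_mul _ (by fun_prop), h]
      _ = _ := by
          rw [← ENNReal.ofReal_mul (by positivity), ← ENNReal.ofReal_mul hG.le]
          congr 1
          rw [one_div, Real.inv_rpow ht0.le, show (1 - p) - 1 = -p by ring,
            Real.rpow_add ht0, Real.rpow_one, Real.rpow_neg ht0.le, one_mul]
          field_simp
  rw [setLIntegral_congr_fun measurableSet_Ioi h1, lintegral_lintegral_swap (by fun_prop),
    setLIntegral_congr_fun measurableSet_Ioi h2, lintegral_const_mul _ (by fun_prop),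
    lintegral_rpow_mul_exp_neg (by linarith) one_pos,
    ← ENNReal.ofReal_mul (Real.Gamma_pos_of_pos (by linarith)).le, Real.Gamma_add_one hp.ne']
  congr 1
  have := Real.Gamma_mul_Gamma_one_sub p
  simp only [div_one, Real.one_rpow, one_mul]
  rw [mul_assoc, this]
  ring

lemma integrableOn_rpow_div_one_add_sq {p : ℝ} (hp : 0 < p) (hp1 : p < 1) :
    IntegrableOn (fun s : ℝ => s ^ p / (1 + s) ^ 2) (Set.Ioi 0) := by
  refine ⟨(by fun_prop : Measurable fun s : ℝ => s ^ p / (1 + s) ^ 2).aestronglyMeasurable, ?_⟩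
  rw [hasFiniteIntegral_iff_ofReal, lintegral_rpow_div_one_add_sq hp hp1]
  · exact ENNReal.ofReal_lt_top
  · refine (ae_restrict_iff' measurableSet_Ioi).2 (Eventually.of_forall fun s hs => ?_)
    have : 0 < s := hs
    show 0 ≤ s ^ p / (1 + s) ^ 2
    positivity

lemma integral_rpow_div_one_add_sq {p : ℝ} (hp : 0 < p) (hp1 : p < 1) :
    ∫ s in Set.Ioi 0, s ^ p / (1 + s) ^ 2 = p * Real.pi / Real.sin (Real.pi * p) := by
  have hsin : 0 < Real.sin (Real.pi * p) :=
    Real.sin_pos_of_pos_of_lt_pi (by positivity) (by nlinarith [Real.pi_pos])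
  rw [integral_eq_lintegral_of_nonneg_ae _ (integrableOn_rpow_div_one_add_sq hp hp1).1,
    lintegral_rpow_div_one_add_sq hp hp1, ENNReal.toReal_ofReal (by positivity)]
  refine (ae_restrict_iff' measurableSet_Ioi).2 (Eventually.of_forall fun s hs => ?_)
  have : 0 < s := hs
  show 0 ≤ s ^ p / (1 + s) ^ 2
  positivity

end BetaIntegral

/-! ### Integrals over (0, 1) with denominator e + k v -/

section Integrals

variable {e k : ℝ} (he : 0 < e) (hk : 0 < k)
include he hk

lemma add_mul_pos_of_mem {v : ℝ} (hv : v ∈ Set.uIcc (0 : ℝ) 1) : 0 < e + k * v := by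
  rw [Set.uIcc_of_le zero_le_one] at hv
  have := hv.1
  positivity

lemma intervalIntegrable_div_add_mul {f : ℝ → ℝ} (hf : ContinuousOn f (Set.uIcc 0 1)) (n : ℕ) :
    IntervalIntegrable (fun v => f v / (e + k * v) ^ n) volume 0 1 :=
  (hf.div (by fun_prop) fun v hv =>
    pow_ne_zero n (add_mul_pos_of_mem he hk hv).ne').intervalIntegrable

lemma integral_one_div_add_mul :
    ∫ v in (0 : ℝ)..1, 1 / (e + k * v) = Real.log ((e + k) / e) / k := by
  have hd : ∀ v ∈ Set.uIcc (0 : ℝ) 1,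
      HasDerivAt (fun v => Real.log (e + k * v) / k) (1 / (e + k * v)) v := by
    intro v hv
    have hpos := add_mul_pos_of_mem he hk hv
    have h1 : HasDerivAt (fun v => e + k * v) k v := by
      simpa using ((hasDerivAt_id v).const_mul k).const_add e
    refine ((h1.log hpos.ne').div_const k).congr_deriv ?_
    field_simp
  rw [intervalIntegral.integral_eq_sub_of_hasDerivAt hd
    (by simpa using intervalIntegrable_div_add_mul he hk (f := fun _ => 1) (by fun_prop) 1),
    Real.log_div (by positivity) he.ne']
  simp
  ring

lemma integral_div_add_mul_sq :
    ∫ v in (0 : ℝ)..1, v / (e + k * v) ^ 2 =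
      (Real.log ((e + k) / e) + e / (e + k) - 1) / k ^ 2 := by
  have hd : ∀ v ∈ Set.uIcc (0 : ℝ) 1,
      HasDerivAt (fun v => (Real.log (e + k * v) + e / (e + k * v)) / k ^ 2)
        (v / (e + k * v) ^ 2) v := by
    intro v hv
    have hpos := add_mul_pos_of_mem he hk hv
    have h1 : HasDerivAt (fun v => e + k * v) k v := by
      simpa using ((hasDerivAt_id v).const_mul k).const_add e
    refine (((h1.log hpos.ne').add ((hasDerivAt_const v e).div h1 hpos.ne')).div_const
      (k ^ 2)).congr_deriv ?_
    field_simp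
    ring
  rw [intervalIntegral.integral_eq_sub_of_hasDerivAt hd
    (intervalIntegrable_div_add_mul he hk (f := fun v => v) (by fun_prop) 2),
    Real.log_div (by positivity) he.ne']
  simp [he.ne']
  ring

/-- Dropping `e` from the denominator leaves `v^(p - 2)`, integrable at 0 because `p > 1`; the bound
is uniform in `e`. -/
lemma integral_rpow_div_add_mul_sq_le {p : ℝ} (hp : 1 < p) :
    ∫ v in (0 : ℝ)..1, v ^ p / (e + k * v) ^ 2 ≤ 1 / (k ^ 2 * (p - 1)) := by
  have h1 : ∫ v in (0 : ℝ)..1, v ^ (p - 2) = 1 / (p - 1) := by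
    rw [integral_rpow (Or.inl (by linarith)), Real.one_rpow, Real.zero_rpow (by linarith)]
    congr 1 <;> ring
  have hI := intervalIntegrable_div_add_mul he hk (f := fun v => v ^ p)
    (Real.continuous_rpow_const (by linarith)).continuousOn 2
  have hI2 : IntervalIntegrable (fun v : ℝ => 1 / k ^ 2 * v ^ (p - 2)) volume 0 1 :=
    (intervalIntegral.intervalIntegrable_rpow' (by linarith)).const_mul _
  calc _ ≤ ∫ v in (0 : ℝ)..1, 1 / k ^ 2 * v ^ (p - 2) := by
        refine intervalIntegral.integral_mono_on_of_le_Ioo zero_le_one hI hI2 fun v hv => ?_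
        have hv0 := hv.1
        have h2 : v ^ p = v ^ (p - 2) * v ^ 2 := by
          rw [← Real.rpow_natCast, ← Real.rpow_add hv0]; norm_num
        rw [h2, div_le_iff₀ (by positivity)]
        have h3 : (k * v) ^ 2 ≤ (e + k * v) ^ 2 := by gcongr; linarith
        calc v ^ (p - 2) * v ^ 2 = 1 / k ^ 2 * v ^ (p - 2) * (k * v) ^ 2 := by field_simp
          _ ≤ _ := by gcongr
    _ = _ := by
        rw [intervalIntegral.integral_const_mul, h1]
        field_simp

/-- Substitute `s = k v / e`; the power of `e` that comes out is the growth rate when `p < 1`. -/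
lemma integral_rpow_div_add_mul_sq_eq {p : ℝ} :
    ∫ v in (0 : ℝ)..1, v ^ p / (e + k * v) ^ 2 =
      e ^ (p - 1) * k ^ (-1 - p) * ∫ s in (0 : ℝ)..(k / e), s ^ p / (1 + s) ^ 2 := by
  have hc : k / e ≠ 0 := by positivity
  have h := intervalIntegral.integral_comp_mul_left (a := 0) (b := 1)
    (fun s : ℝ => s ^ p / (1 + s) ^ 2) hc
  rw [mul_zero, mul_one, smul_eq_mul] at h
  have h2 : ∫ s in (0 : ℝ)..(k / e), s ^ p / (1 + s) ^ 2 =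
      (k / e) * ∫ v in (0 : ℝ)..1, (k / e * v) ^ p / (1 + k / e * v) ^ 2 := by
    rw [h]; field_simp
  rw [h2, ← mul_assoc, ← intervalIntegral.integral_const_mul]
  refine intervalIntegral.integral_congr_Ioo_of_le zero_le_one fun v hv => ?_
  have hv0 := hv.1
  rw [Real.mul_rpow (by positivity) hv0.le, Real.div_rpow hk.le he.le,
    Real.rpow_sub he, sub_eq_add_neg (-1 : ℝ), Real.rpow_add hk, Real.rpow_neg hk.le,
    Real.rpow_neg hk.le, Real.rpow_one, Real.rpow_one]
  have : e ^ p ≠ 0 := by positivity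
  have : k ^ p ≠ 0 := by positivity
  field_simp

end Integrals

/-! ### Finiteness of the mean -/

section Mean

/-- The mean sojourn time of a job with service requirement `b`. -/
noncomputable def fbMean (F : Measure ℝ) (lam b : ℝ) : ℝ :=
  (b + lam * truncSq F b / (2 * (1 - lam * truncMean F b))) / (1 - lam * truncMean F b)

variable {F : Measure ℝ} [IsProbabilityMeasure F] {lam : ℝ}

lemma measurable_truncMean : Measurable (truncMean F) :=
  ((by fun_prop : Measurable fun r : ℝ × ℝ => min r.2 r.1).stronglyMeasurable.integral_prod_right'
    (ν := F)).measurable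

lemma measurable_truncSq : Measurable (truncSq F) :=
  ((by fun_prop : Measurable fun r : ℝ × ℝ => min r.2 r.1 ^ 2).stronglyMeasurable.integral_prod_right'
    (ν := F)).measurable

lemma measurable_fbMean : Measurable (fbMean F lam) := by
  have h1 := measurable_truncMean (F := F)
  have h2 := measurable_truncSq (F := F)
  unfold fbMean
  fun_prop

lemma truncMean_le (hF : ∀ᵐ b ∂F, 0 < b) (hint : Integrable (fun b => b) F) {x : ℝ} (hx : 0 < x) :
    truncMean F x ≤ ∫ b, b ∂F :=
  integral_mono (integrable_min hF hx) hint fun _ => min_le_left _ _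

lemma truncSq_le (hF : ∀ᵐ b ∂F, 0 < b) (hint : Integrable (fun b => b) F) {x : ℝ} (hx : 0 < x) :
    truncSq F x ≤ x * ∫ b, b ∂F := by
  rw [← integral_const_mul]
  refine integral_mono_ae (integrable_min_pow hF hx 2) (hint.const_mul x) ?_
  filter_upwards [hF] with b hb
  have h0 : 0 ≤ min b x := le_min hb.le hx.le
  calc min b x ^ 2 = min b x * min b x := sq _
    _ ≤ x * b := mul_le_mul (min_le_right _ _) (min_le_left _ _) h0 hx.le

omit [IsProbabilityMeasure F] in
lemma fbMean_nonneg (hlam : 0 < lam) {b : ℝ} (hb : 0 < b) (hload : lam * truncMean F b < 1) :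
    0 ≤ fbMean F lam b := by
  have h1 : 0 < 1 - lam * truncMean F b := by linarith
  have := truncSq_nonneg F b
  unfold fbMean
  positivity

/-- By `truncSq_le` the truncated second moment is at most `b E[B]`, so `fbMean` grows at most
linearly in `b` and a finite first moment of `B` suffices. -/
lemma lintegral_fbMean_ne_top (hlam : 0 < lam) (hF : ∀ᵐ b ∂F, 0 < b)
    (hint : Integrable (fun b => b) F) (hload : lam * ∫ b, b ∂F < 1) :
    ∫⁻ b, ENNReal.ofReal (fbMean F lam b) ∂F ≠ ∞ := by
  set E := ∫ b, b ∂F with hE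
  have hd : 0 < 1 - lam * E := by linarith
  have hE0 : 0 ≤ E := integral_nonneg_of_ae (hF.mono fun _ h => h.le)
  refine ((lintegral_mono_ae ?_).trans_lt
    (hint.const_mul ((1 + lam * E / (2 * (1 - lam * E))) / (1 - lam * E))).lintegral_lt_top).ne
  filter_upwards [hF] with b hb
  refine ENNReal.ofReal_le_ofReal ?_
  have h1 : 1 - lam * E ≤ 1 - lam * truncMean F b := by
    have := mul_le_mul_of_nonneg_left (truncMean_le hF hint hb) hlam.le
    linarith
  have h2 := truncSq_le hF hint hb
  have h3 := truncSq_nonneg F b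
  have h4 : 0 < 1 - lam * truncMean F b := by linarith
  calc fbMean F lam b ≤ (b + lam * (b * E) / (2 * (1 - lam * E))) / (1 - lam * E) := by
        unfold fbMean
        gcongr
    _ = _ := by ring

lemma toReal_lintegral_fbMean (hlam : 0 < lam) (hF : ∀ᵐ b ∂F, 0 < b)
    (hint : Integrable (fun b => b) F) (hload : lam * ∫ b, b ∂F < 1) :
    (∫⁻ b, ENNReal.ofReal (fbMean F lam b) ∂F).toReal = ∫ b, fbMean F lam b ∂F := by
  rw [integral_eq_lintegral_of_nonneg_ae _ measurable_fbMean.aestronglyMeasurable]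
  filter_upwards [hF] with b hb
  refine fbMean_nonneg hlam hb (lt_of_le_of_lt ?_ hload)
  exact mul_le_mul_of_nonneg_left (truncMean_le hF hint hb) hlam.le

end Mean

/-! ### The mean sojourn time for the Pareto law -/

section ParetoMean

variable {p : ℝ} (hp : 0 < p) {xL : ℝ} (hxL : 0 < xL) {F : Measure ℝ} [IsProbabilityMeasure F]
  (hF : ∀ x : ℝ, xL ≤ x → F.real (Set.Ioi x) = (x / xL) ^ (-((1 + p) / p)))
include hp hxL hF

lemma integral_fbMean_pareto (hp1 : p ≠ 1) {ρ : ℝ} (hρ : ρ ∈ Set.Ioo (0 : ℝ) 1) :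
    ∫ b, fbMean F (ρ / ∫ x, x ∂F) b ∂F =
      (1 + p) * xL * (∫ v in (0 : ℝ)..1, 1 / ((1 - ρ) + ρ * (p / (1 + p)) * v)) +
      ρ * xL / (2 * (1 - p)) *
        ((1 + p) * (∫ v in (0 : ℝ)..1, v ^ p / ((1 - ρ) + ρ * (p / (1 + p)) * v) ^ 2) -
          2 * p * ∫ v in (0 : ℝ)..1, v / ((1 - ρ) + ρ * (p / (1 + p)) * v) ^ 2) := by
  have he : 0 < 1 - ρ := by linarith [hρ.2]
  have hρ0 := hρ.1
  have hk : 0 < ρ * (p / (1 + p)) := by positivity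
  have h1p : 1 - p ≠ 0 := sub_ne_zero.2 hp1.symm
  have i1 : IntervalIntegrable (fun v => 1 / ((1 - ρ) + ρ * (p / (1 + p)) * v)) volume 0 1 := by
    simpa using intervalIntegrable_div_add_mul he hk (f := fun _ => 1) (by fun_prop) 1
  have i2 := intervalIntegrable_div_add_mul he hk (f := fun v => v ^ p)
    (Real.continuous_rpow_const hp.le).continuousOn 2
  have i3 := intervalIntegrable_div_add_mul he hk (f := fun v => v) (by fun_prop) 2
  rw [integral_pareto hp hxL hF measurable_fbMean, ← intervalIntegral.integral_const_mul,
    ← intervalIntegral.integral_const_mul, ← intervalIntegral.integral_const_mul,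
    ← intervalIntegral.integral_sub (i2.const_mul _) (i3.const_mul _),
    ← intervalIntegral.integral_const_mul,
    ← intervalIntegral.integral_add (i1.const_mul _)
      (((i2.const_mul _).sub (i3.const_mul _)).const_mul _)]
  refine intervalIntegral.integral_congr_Ioo_of_le zero_le_one fun v hv => ?_
  have hv0 := hv.1
  have hD : 0 < (1 - ρ) + ρ * (p / (1 + p)) * v := by positivity
  have hload : 1 - ρ / ((1 + p) * xL) * (xL * (1 + p - p * v)) =
      (1 - ρ) + ρ * (p / (1 + p)) * v := by
    field_simp
    ring
  simp only [fbMean]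
  rw [integral_pareto_id hp hxL hF, truncMean_pareto hp hxL hF hv, truncSq_pareto hp hxL hF hp1 hv,
    hload]
  set D := (1 - ρ) + ρ * (p / (1 + p)) * v
  rw [Real.rpow_sub hv0, Real.rpow_one, Real.rpow_neg hv0.le]
  have : v ^ p ≠ 0 := by positivity
  field_simp

end ParetoMean

/-! ### Heavy traffic limits of the integrals -/

section Limits

lemma tendsto_one_sub_nhdsLT_one : Tendsto (fun ρ : ℝ => 1 - ρ) (𝓝[<] 1) (𝓝[>] 0) := by
  refine tendsto_nhdsWithin_iff.2 ⟨?_, ?_⟩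
  · have : Tendsto (fun ρ : ℝ => 1 - ρ) (𝓝 1) (𝓝 (1 - 1)) := by
      exact (continuous_const.sub continuous_id).tendsto 1
    rw [sub_self] at this
    exact this.mono_left nhdsWithin_le_nhds
  · filter_upwards [self_mem_nhdsWithin] with ρ hρ
    exact sub_pos.2 (Set.mem_Iio.1 hρ)

lemma tendsto_log_one_div_atTop :
    Tendsto (fun ρ : ℝ => Real.log (1 / (1 - ρ))) (𝓝[<] 1) atTop := by
  simp only [one_div]
  exact Real.tendsto_log_atTop.comp (tendsto_inv_nhdsGT_zero.comp tendsto_one_sub_nhdsLT_one)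

lemma eventually_mem_Ioo : ∀ᶠ ρ : ℝ in 𝓝[<] 1, ρ ∈ Set.Ioo (0 : ℝ) 1 :=
  Ioo_mem_nhdsLT zero_lt_one

lemma tendsto_id_nhdsLT : Tendsto (fun ρ : ℝ => ρ) (𝓝[<] 1) (𝓝 1) :=
  tendsto_id.mono_left nhdsWithin_le_nhds

variable {c : ℝ} (hc : 0 < c)
include hc

omit hc in
lemma tendsto_mul_const_nhdsLT : Tendsto (fun ρ : ℝ => ρ * c) (𝓝[<] 1) (𝓝 c) := by
  simpa using tendsto_id_nhdsLT.mul_const c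

lemma tendsto_log_ratio :
    Tendsto (fun ρ : ℝ => Real.log ((1 - ρ + ρ * c) / (1 - ρ)) / Real.log (1 / (1 - ρ)))
      (𝓝[<] 1) (𝓝 1) := by
  have h1 : Tendsto (fun ρ : ℝ => Real.log (1 - ρ + ρ * c)) (𝓝[<] 1) (𝓝 (Real.log (0 + c))) :=
    (((tendsto_one_sub_nhdsLT_one.mono_right nhdsWithin_le_nhds).add
      tendsto_mul_const_nhdsLT).log (by simpa using hc.ne'))
  have h2 := (h1.div_atTop tendsto_log_one_div_atTop).add_const 1
  rw [zero_add] at h2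
  refine h2.congr' ?_
  filter_upwards [eventually_mem_Ioo, tendsto_log_one_div_atTop.eventually_gt_atTop 0] with ρ hρ hL
  have he : 0 < 1 - ρ := by linarith [hρ.2]
  have hρ0 := hρ.1
  have : Real.log ((1 - ρ + ρ * c) / (1 - ρ)) =
      Real.log (1 - ρ + ρ * c) + Real.log (1 / (1 - ρ)) := by
    rw [Real.log_div (by positivity) he.ne', one_div, Real.log_inv]
    ring
  rw [div_add_one hL.ne', this]

lemma tendsto_integral_one_div :
    Tendsto (fun ρ : ℝ => (∫ v in (0 : ℝ)..1, 1 / ((1 - ρ) + ρ * c * v)) /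
      Real.log (1 / (1 - ρ))) (𝓝[<] 1) (𝓝 (1 / c)) := by
  refine ((tendsto_log_ratio hc).div tendsto_mul_const_nhdsLT hc.ne').congr' ?_
  filter_upwards [eventually_mem_Ioo] with ρ hρ
  rw [integral_one_div_add_mul (by linarith [hρ.2]) (mul_pos hρ.1 hc)]
  simp only [Pi.div_apply]
  ring

lemma tendsto_integral_div_sq :
    Tendsto (fun ρ : ℝ => (∫ v in (0 : ℝ)..1, v / ((1 - ρ) + ρ * c * v) ^ 2) /
      Real.log (1 / (1 - ρ))) (𝓝[<] 1) (𝓝 (1 / c ^ 2)) := by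
  have h0 := tendsto_one_sub_nhdsLT_one.mono_right nhdsWithin_le_nhds
  have h1 : Tendsto (fun ρ : ℝ => (1 - ρ) / (1 - ρ + ρ * c) - 1) (𝓝[<] 1) (𝓝 (0 / (0 + c) - 1)) :=
    (h0.div (h0.add tendsto_mul_const_nhdsLT) (by simpa using hc.ne')).sub_const 1
  have h2 := ((tendsto_log_ratio hc).add (h1.div_atTop tendsto_log_one_div_atTop)).div
    (tendsto_mul_const_nhdsLT.pow 2) (by positivity)
  rw [add_zero] at h2
  refine h2.congr' ?_
  filter_upwards [eventually_mem_Ioo] with ρ hρ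
  rw [integral_div_add_mul_sq (by linarith [hρ.2]) (mul_pos hρ.1 hc)]
  simp only [Pi.div_apply]
  ring

lemma tendsto_integral_rpow_div_sq_of_one_lt {p : ℝ} (hp : 1 < p) :
    Tendsto (fun ρ : ℝ => (∫ v in (0 : ℝ)..1, v ^ p / ((1 - ρ) + ρ * c * v) ^ 2) /
      Real.log (1 / (1 - ρ))) (𝓝[<] 1) (𝓝 0) := by
  have h1 : Tendsto (fun ρ : ℝ => 1 / ((ρ * c) ^ 2 * (p - 1))) (𝓝[<] 1)
      (𝓝 (1 / (c ^ 2 * (p - 1)))) :=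
    tendsto_const_nhds.div ((tendsto_mul_const_nhdsLT.pow 2).mul_const (p - 1))
      (mul_pos (by positivity) (by linarith)).ne'
  refine tendsto_of_tendsto_of_tendsto_of_le_of_le' tendsto_const_nhds
    (h1.div_atTop tendsto_log_one_div_atTop) ?_ ?_
  · filter_upwards [eventually_mem_Ioo, tendsto_log_one_div_atTop.eventually_gt_atTop 0]
      with ρ hρ hL
    refine div_nonneg (intervalIntegral.integral_nonneg zero_le_one fun v hv => ?_) hL.le
    have := hv.1
    positivity
  · filter_upwards [eventually_mem_Ioo, tendsto_log_one_div_atTop.eventually_gt_atTop 0]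
      with ρ hρ hL
    gcongr
    exact integral_rpow_div_add_mul_sq_le (by linarith [hρ.2]) (mul_pos hρ.1 hc) hp

/-- After rescaling, the upper limit `ρ c / (1 - ρ)` tends to infinity and the integral fills up to
the full Beta integral. -/
lemma tendsto_integral_rpow_div_sq_of_lt_one {p : ℝ} (hp : 0 < p) (hp1 : p < 1) :
    Tendsto (fun ρ : ℝ => (∫ v in (0 : ℝ)..1, v ^ p / ((1 - ρ) + ρ * c * v) ^ 2) *
      (1 - ρ) ^ (1 - p)) (𝓝[<] 1)
      (𝓝 (c ^ (-1 - p) * (p * Real.pi / Real.sin (Real.pi * p)))) := by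
  have h1 : Tendsto (fun ρ : ℝ => ρ * c / (1 - ρ)) (𝓝[<] 1) atTop := by
    simp only [div_eq_mul_inv]
    exact tendsto_mul_const_nhdsLT.pos_mul_atTop hc
      (tendsto_inv_nhdsGT_zero.comp tendsto_one_sub_nhdsLT_one)
  have h2 := intervalIntegral_tendsto_integral_Ioi 0 (integrableOn_rpow_div_one_add_sq hp hp1) h1
  rw [integral_rpow_div_one_add_sq hp hp1] at h2
  refine ((tendsto_mul_const_nhdsLT.rpow_const (p := -1 - p) (Or.inl hc.ne')).mul h2).congr' ?_
  filter_upwards [eventually_mem_Ioo] with ρ hρ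
  have he : 0 < 1 - ρ := by linarith [hρ.2]
  rw [integral_rpow_div_add_mul_sq_eq he (mul_pos hρ.1 hc), show 1 - p = -(p - 1) by ring,
    Real.rpow_neg he.le]
  have : (1 - ρ) ^ (p - 1) ≠ 0 := by positivity
  field_simp

omit hc in
lemma tendsto_log_mul_rpow {s : ℝ} (hs : 0 < s) :
    Tendsto (fun ρ : ℝ => Real.log (1 / (1 - ρ)) * (1 - ρ) ^ s) (𝓝[<] 1) (𝓝 0) := by
  have := ((tendsto_log_mul_rpow_nhdsGT_zero hs).comp tendsto_one_sub_nhdsLT_one).neg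
  rw [neg_zero] at this
  refine this.congr fun ρ => ?_
  simp [Real.log_inv]

end Limits

/-! ### Heavy traffic asymptotics of the mean -/

section Asymptotics

variable {p : ℝ} (hp : 0 < p) {xL : ℝ} (hxL : 0 < xL) {F : Measure ℝ} [IsProbabilityMeasure F]
  (hF : ∀ x : ℝ, xL ≤ x → F.real (Set.Ioi x) = (x / xL) ^ (-((1 + p) / p)))
include hp hxL hF

/-- Both logarithmic integrals contribute: the service part gives `(1 + p)² xL / p` and the waiting
part multiplies this by a further `1 / (p - 1)`. Their sum is the stated constant. -/
lemma tendsto_fbMean_of_one_lt (hp1 : 1 < p) :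
    Tendsto (fun ρ : ℝ => (∫ b, fbMean F (ρ / ∫ x, x ∂F) b ∂F) / Real.log (1 / (1 - ρ))) (𝓝[<] 1)
      (𝓝 ((1 + p) / (p - 1) * ((1 + p) * xL))) := by
  have hc : 0 < p / (1 + p) := by positivity
  have h := ((tendsto_integral_one_div hc).const_mul ((1 + p) * xL)).add
    (((tendsto_id_nhdsLT.mul_const xL).div_const (2 * (1 - p))).mul
      (((tendsto_integral_rpow_div_sq_of_one_lt hc hp1).const_mul (1 + p)).sub
        ((tendsto_integral_div_sq hc).const_mul (2 * p))))
  have hp' : p - 1 ≠ 0 := by linarith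
  have hp'' : 1 - p ≠ 0 := by linarith
  rw [show (1 + p) * xL * (1 / (p / (1 + p))) + 1 * xL / (2 * (1 - p)) *
    ((1 + p) * 0 - 2 * p * (1 / (p / (1 + p)) ^ 2)) = (1 + p) / (p - 1) * ((1 + p) * xL) by
      rw [show 1 - p = -(p - 1) by ring]; field_simp; ring] at h
  refine h.congr' ?_
  filter_upwards [eventually_mem_Ioo] with ρ hρ
  rw [integral_fbMean_pareto hp hxL hF hp1.ne' hρ]
  ring

/-- The factor `(1 - ρ)^(1 - p)` kills the logarithmic integrals, so only the one with `v^p`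
survives. -/
lemma tendsto_fbMean_of_lt_one (hp1 : p < 1) :
    Tendsto (fun ρ : ℝ => (∫ b, fbMean F (ρ / ∫ x, x ∂F) b ∂F) * (1 - ρ) ^ (1 - p)) (𝓝[<] 1)
      (𝓝 (xL * (1 + p) / (2 * (1 - p)) *
        ((p / (1 + p)) ^ (-1 - p) * (p * Real.pi / Real.sin (Real.pi * p))))) := by
  have hc : 0 < p / (1 + p) := by positivity
  have hs : 0 < 1 - p := by linarith
  have hL := tendsto_log_mul_rpow hs
  have h1 := (tendsto_integral_one_div hc).mul hL
  have h2 := (tendsto_integral_div_sq hc).mul hL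
  have h := (h1.const_mul ((1 + p) * xL)).add
    (((tendsto_id_nhdsLT.mul_const xL).div_const (2 * (1 - p))).mul
      (((tendsto_integral_rpow_div_sq_of_lt_one hc hp hp1).const_mul (1 + p)).sub
        (h2.const_mul (2 * p))))
  simp only [mul_zero, zero_add, sub_zero, one_mul] at h
  rw [show xL / (2 * (1 - p)) * ((1 + p) * ((p / (1 + p)) ^ (-1 - p) *
    (p * Real.pi / Real.sin (Real.pi * p)))) = xL * (1 + p) / (2 * (1 - p)) *
        ((p / (1 + p)) ^ (-1 - p) * (p * Real.pi / Real.sin (Real.pi * p))) by ring] at h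
  refine h.congr' ?_
  filter_upwards [eventually_mem_Ioo, tendsto_log_one_div_atTop.eventually_gt_atTop 0] with ρ hρ hL
  rw [integral_fbMean_pareto hp hxL hF hp1.ne hρ]
  field_simp

end Asymptotics

/-! ### Conclusion -/

/-- The steady-state sojourn time law of an M/GI/1 FB queue with stable load, and its mean. -/
theorem exists_steadyState_lintegral_eq {Ω : Type*} [MeasurableSpace Ω] {P : Measure Ω}
    [IsProbabilityMeasure P] {F : Measure ℝ} [IsProbabilityMeasure F] {lam : ℝ}
    {A B : ℕ → Ω → ℝ} {S : ℕ → ℝ → Ω → ℝ} (h : IsMGI1FB P lam F A B S) (hlam : 0 < lam)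
    (hF : ∀ᵐ b ∂F, 0 < b) (hint : Integrable (fun b => b) F) (hload : lam * ∫ b, b ∂F < 1) :
    ∃ ν : ProbabilityMeasure ℝ≥0∞, IsSteadyStateSojournLaw P A B S ν ∧
      ∫⁻ t, t ∂(ν : Measure ℝ≥0∞) = ∫⁻ b, ENNReal.ofReal (fbMean F lam b) ∂F := by
  have := isProbabilityMeasure_expMeasure hlam
  refine ⟨_, h.isSteadyState hF, lintegral_limitLaw hlam hF fun b hb => ?_⟩
  exact (mul_le_mul_of_nonneg_left (truncMean_le hF hint hb) hlam.le).trans_lt hload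

end FBQueue

open FBQueue in
theorem corollary1 (xL α : ℝ) (hxL : 0 < xL) (hα : 1 < α)
    (F : Measure ℝ) [IsProbabilityMeasure F]
    (hF : ∀ x : ℝ, xL ≤ x → F.real (Set.Ioi x) = (x / xL) ^ (-α))
    (Ω : ℝ → Type*) [∀ ρ, MeasurableSpace (Ω ρ)]
    (P : ∀ ρ, Measure (Ω ρ)) [∀ ρ, IsProbabilityMeasure (P ρ)]
    (A B : ∀ ρ, ℕ → Ω ρ → ℝ) (S : ∀ ρ, ℕ → ℝ → Ω ρ → ℝ)
    (hQ : ∀ ρ ∈ Set.Ioo (0 : ℝ) 1,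
      FBQueue.IsMGI1FB (P ρ) (ρ / ∫ x, x ∂F) F (A ρ) (B ρ) (S ρ)) :
    ∃ ν : ℝ → ProbabilityMeasure ℝ≥0∞,
      (∀ ρ ∈ Set.Ioo (0 : ℝ) 1,
        FBQueue.IsSteadyStateSojournLaw (P ρ) (A ρ) (B ρ) (S ρ) (ν ρ) ∧
        ∫⁻ t, t ∂(ν ρ : Measure ℝ≥0∞) ≠ ∞) ∧
      (α < 2 →
        (fun ρ : ℝ => (∫⁻ t, t ∂(ν ρ : Measure ℝ≥0∞)).toReal) ~[𝓝[<] 1]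
          (fun ρ : ℝ => α / (2 - α) * (∫ x, x ∂F) * Real.log (1 / (1 - ρ)))) ∧
      (2 < α →
        (fun ρ : ℝ => (∫⁻ t, t ∂(ν ρ : Measure ℝ≥0∞)).toReal) ~[𝓝[<] 1]
          (fun ρ : ℝ => (Real.pi / (α - 1)) / (2 * Real.sin (Real.pi / (α - 1))) *
            (((∫ x, x ^ 2 ∂F) * α ^ (α / (α - 1))) /
              (xL * (1 - ρ) ^ ((α - 2) / (α - 1)))))) := by
  have hα1 : 0 < α - 1 := by linarith
  -- With `p = 1 / (α - 1)`, the cases `α < 2` and `α > 2` become `p > 1` and `p < 1`.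
  obtain ⟨p, hp, rfl⟩ : ∃ p : ℝ, 0 < p ∧ α = (1 + p) / p :=
    ⟨1 / (α - 1), by positivity, by field_simp; ring⟩
  have hpos := ae_pareto_pos hp hxL hF
  have hint := integrable_pareto_id hp hxL hF
  have hE := integral_pareto_id hp hxL hF
  have hE0 : 0 < ∫ x, x ∂F := by rw [hE]; positivity
  have hload : ∀ ρ ∈ Set.Ioo (0 : ℝ) 1, ρ / (∫ x, x ∂F) * ∫ x, x ∂F < 1 := fun ρ hρ => by
    rw [div_mul_cancel₀ _ hE0.ne']
    exact hρ.2
  have hν : ∀ ρ : ℝ, ∃ ν : ProbabilityMeasure ℝ≥0∞, ρ ∈ Set.Ioo (0 : ℝ) 1 →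
      IsSteadyStateSojournLaw (P ρ) (A ρ) (B ρ) (S ρ) ν ∧
      ∫⁻ t, t ∂(ν : Measure ℝ≥0∞) =
        ∫⁻ b, ENNReal.ofReal (fbMean F (ρ / ∫ x, x ∂F) b) ∂F := fun ρ => by
    by_cases hρ : ρ ∈ Set.Ioo (0 : ℝ) 1
    · obtain ⟨ν, h⟩ := exists_steadyState_lintegral_eq (hQ ρ hρ) (div_pos hρ.1 hE0) hpos hint
        (hload ρ hρ)
      exact ⟨ν, fun _ => h⟩
    -- Outside `(0, 1)` the law is irrelevant; any probability measure serves.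
    · exact ⟨⟨Measure.dirac 0, inferInstance⟩, fun h => absurd h hρ⟩
  choose ν hν using hν
  have hmean : (fun ρ : ℝ => ∫ b, fbMean F (ρ / ∫ x, x ∂F) b ∂F) =ᶠ[𝓝[<] 1]
      fun ρ : ℝ => (∫⁻ t, t ∂(ν ρ : Measure ℝ≥0∞)).toReal := by
    filter_upwards [eventually_mem_Ioo] with ρ hρ
    rw [(hν ρ hρ).2, toReal_lintegral_fbMean (div_pos hρ.1 hE0) hpos hint (hload ρ hρ)]
  refine ⟨ν, fun ρ hρ => ⟨(hν ρ hρ).1, ?_⟩, fun hα2 => ?_, fun hα2 => ?_⟩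
  · rw [(hν ρ hρ).2]
    exact lintegral_fbMean_ne_top (div_pos hρ.1 hE0) hpos hint (hload ρ hρ)
  · have hp1 : 1 < p := by
      rw [div_lt_iff₀ hp] at hα2
      linarith
    have hp1' : 0 < p - 1 := by linarith
    refine IsEquivalent.congr_left ?_ hmean
    set c := (1 + p) / (p - 1) * ((1 + p) * xL) with hc
    have hc0 : c ≠ 0 := by positivity
    have hconst : (1 + p) / p / (2 - (1 + p) / p) * ∫ x, x ∂F = c := by
      rw [hE, hc, show 2 - (1 + p) / p = (p - 1) / p by field_simp; ring]
      field_simp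
    rw [hconst]
    refine isEquivalent_of_tendsto_one ?_
    have h := (tendsto_fbMean_of_one_lt hp hxL hF hp1).div_const c
    rw [div_self hc0] at h
    refine h.congr fun ρ => ?_
    simp only [Pi.div_apply]
    rw [div_div, mul_comm c]
  · have hp1 : p < 1 := by
      rw [lt_div_iff₀ hp] at hα2
      linarith
    have hp1' : 0 < 1 - p := by linarith
    refine IsEquivalent.congr_left ?_ hmean
    have hsin : 0 < Real.sin (Real.pi * p) :=
      Real.sin_pos_of_pos_of_lt_pi (by positivity) (by nlinarith [Real.pi_pos])
    set c := xL * (1 + p) / (2 * (1 - p)) *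
      ((p / (1 + p)) ^ (-1 - p) * (p * Real.pi / Real.sin (Real.pi * p))) with hc
    have hc0 : c ≠ 0 := by
      have := Real.pi_pos
      positivity
    -- These identities translate the exponents and constants written in `α` into `p`.
    have e1 : (1 + p) / p - 1 = 1 / p := by field_simp; ring
    have e2 : Real.pi / ((1 + p) / p - 1) = Real.pi * p := by rw [e1]; field_simp
    have e3 : (1 + p) / p / ((1 + p) / p - 1) = 1 + p := by rw [e1]; field_simp
    have e4 : ((1 + p) / p - 2) / ((1 + p) / p - 1) = 1 - p := by rw [e1]; field_simp; ring
    have e5 : ((1 + p) / p) ^ (1 + p) = (p / (1 + p)) ^ (-1 - p) := by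
      rw [show -1 - p = -(1 + p) by ring, Real.rpow_neg (by positivity),
        ← Real.inv_rpow (by positivity), inv_div]
    rw [e2, e3, e4, e5, integral_pareto_sq hp hxL hF hp1]
    refine isEquivalent_of_tendsto_one ?_
    have h := (tendsto_fbMean_of_lt_one hp hxL hF hp1).div_const c
    rw [div_self hc0] at h
    refine h.congr' ?_
    filter_upwards [eventually_mem_Ioo] with ρ hρ
    have he : 0 < 1 - ρ := by linarith [hρ.2]
    have hr : (1 - ρ) ^ (1 - p) ≠ 0 := by positivity
    have hq : (p / (1 + p)) ^ (-1 - p) ≠ 0 := by positivity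
    simp only [Pi.div_apply, hc]
    field_simp
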